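/- **Conventions.** All objects are smooth; $\alpha\otimes_s\beta=\frac12(\alpha\otimes\beta+\beta\otimes\alpha)$. *Hypersurface data* on a manifold $\mathcal N$ is $\{\mathcal N,\gamma,\ell,\ell^{(2)},Y\}$ with $\gamma,Y$ symmetric 2-covariant tensors, $\ell$ a covector and $\ell^{(2)}$ a scalar such that the form $\mathcal A((W,a),(Z,b))=\gamma(W,Z)+a\,\ell(Z)+b\,\ell(W)+ab\,\ell^{(2)}$ on $T_p\mathcal N\times\mathbb R$ is non-degenerate at every $p$; dropping $Y$ gives *metric* hypersurface data. The symmetric tensor $P^{ab}$, the vector $n^a$ and the scalar $n^{(2)}$ are defined by $$\gamma_{ab}n^b+n^{(2)}\ell_a=0,\quad \ell_an^a+n^{(2)}\ell^{(2)}=1,\quad P^{ab}\ell_b+\ell^{(2)}n^a=0,\quad P^{ab}\gamma_{bc}+n^a\ell_c=\delta^a_c ,$$ and the data is *null* if $n^{(2)}=0$. Put $F=\frac12 d\ell$ and $U=\frac12\pounds_n\gamma+\ell\otimes_s dn^{(2)}$. Then $\overset{\circ}{\nabla}$ is the unique torsion-free connection with $\overset{\circ}{\nabla}_a\gamma_{bc}=-\ell_bU_{ac}-\ell_cU_{ab}$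 and $\overset{\circ}{\nabla}_a\ell_b=F_{ab}-\ell^{(2)}U_{ab}$. The data is *embedded* in $(\mathcal M,g)$ with embedding $\iota$ and rigging $\zeta$ (a vector field along $\iota(\mathcal N)$ transversal to it) if $\gamma=\iota^\star g$, $\ell=\iota^\star(g(\zeta,\cdot))$, $\ell^{(2)}=\iota^\star(g(\zeta,\zeta))$ and $Y=\frac12\iota^\star(\pounds_\zeta g)$. **Setup.** Let $(\mathcal M^\pm,g^\pm)$ be Lorentzian manifolds of signature $(-,+,\dots,+)$ and dimension $m+2$ ($m\ge0$), whose boundaries are null and are the images of embeddings $\iota^\pm:\mathcal N\to\mathcal M^\pm$ of a manifold $\mathcal N$ of dimension $m+1$. Let $k^\pm$ be nowhere zero null generators of the boundaries, let $v_\pm$ be functions on the boundaries with $k^\pm(v_\pm)=1$ (so that the boundaries are foliated by the cross-sections $\{v_\pm=\text{const.}\}$), and let $L^\pm$ be null vector fields along the boundaries, orthogonal to the leaves of $v_\pm$, with $g^\pm(L^\pm,k^\pm)=1$. Let $\mathcal D=\{\mathcal N,\gamma,\ell,\ell^{(2)},Y^-\}$ and $\widehat{\mathcal D}=\{\mathcal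 N,\hat\gamma,\hat\ell,\hat\ell^{(2)},\hat Y^+\}$ be null hypersurface data embedded in $(\mathcal M^-,g^-)$ with embedding $\iota^-$ and rigging $L^-$, and in $(\mathcal M^+,g^+)$ with embedding $\iota^+$ and rigging $L^+$, respectively; hatted quantities belong to $\widehat{\mathcal D}$. Assume that the matching is possible with diffeomorphism $\varphi:\mathcal N\to\mathcal N$: there are a nowhere zero function $z$ and a vector field $V$ on $\mathcal N$ with $$\varphi^\star\hat\gamma=\gamma,\qquad z\big(\varphi^\star\hat\ell+\gamma(V,\cdot)\big)=\ell,\qquad z^2\big(\varphi^\star\hat\ell^{(2)}+2(\varphi^\star\hat\ell)(V)+\gamma(V,V)\big)=\ell^{(2)} .$$ The matching rigging on the plus side is $\xi^+=z\,(L^++\iota^+_\star\varphi_\star V)$ ($z$ and $V$ at $p\in\mathcal N$ giving $\xi^+$ at $\iota^+(\varphi(p))$). Put $Y^+=\frac12(\iota^+\circ\varphi)^\star(\pounds_{\xi^+}g^+)$ and $[Y]=Y^+-Y^-$. Define $\lambda=v_-\circ\iota^-$, $v=v_+\circ\iota^+$ and the step function $H=\varphi^\star v=v\circ\varphi$. Let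 $h$ be the metric induced by $\gamma$ on the leaves $\{\lambda=\text{const.}\}\subset\mathcal N$ and $\nabla^h$ its Levi-Civita connection. A basis $\{n,e_A\}_{A=1,\dots,m}$ of $T\mathcal N$ is *adapted* if $e_A(\lambda)=0$; then $h_{AB}=\gamma(e_A,e_B)$, $h^{AB}$ is the inverse matrix, and $\nabla^h_Af=e_A(f)$ for functions $f$. Define $W_A$ by $\varphi_\star e_A=W_A+(\varphi^{-1})^\star(e_A(H))\,\hat n$. **Theorem.** In this setup $n(H)$ vanishes nowhere, $$z=\frac1{n(H)},\qquad V=h^{AB}\nabla^h_AH\Big(\frac{\nabla^h_BH}{2n(H)}\,n-e_B\Big),$$ and $$[Y]_{ab}=\frac1{n(H)}\Big((\varphi^\star\hat Y^+)_{ab}+\frac{h^{AB}\nabla^h_AH\,\nabla^h_BH}{2n(H)}\,U_{ab}-\overset{\circ}{\nabla}_a\overset{\circ}{\nabla}_bH\Big)-Y^-_{ab}.$$ For every adapted basis $\{n,e_A\}$ the components are $$[Y](n,n)=n(H)\,\varphi^\star\big(\hat Y^+(\hat n,\hat n)\big)-Y^-(n,n)-\frac{n(n(H))}{n(H)},$$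 $$[Y](n,e_A)=\varphi^\star\big(\hat Y^+(\hat n,W_A)\big)+(\nabla^h_AH)\,\varphi^\star\big(\hat Y^+(\hat n,\hat n)\big)-Y^-(n,e_A)-\frac{\nabla^h_A(n(H))}{n(H)}+\frac{h^{IJ}\nabla^h_IH}{n(H)}\,U(e_A,e_J),$$ $$\begin{aligned}[Y](e_A,e_B)=\frac1{n(H)}\Big(&\varphi^\star\big(\hat Y^+(W_A,W_B)\big)+(\nabla^h_AH)\,\varphi^\star\big(\hat Y^+(\hat n,W_B)\big)+(\nabla^h_BH)\,\varphi^\star\big(\hat Y^+(\hat n,W_A)\big)\\&+(\nabla^h_AH)(\nabla^h_BH)\,\varphi^\star\big(\hat Y^+(\hat n,\hat n)\big)-n(H)\,Y^-(e_A,e_B)+\frac{h^{IJ}\nabla^h_IH\,\nabla^h_JH}{2n(H)}\,U(e_A,e_B)-\nabla^h_A\nabla^h_BH\Big).\end{aligned}$$ -/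

import Mathlib

open scoped Manifold ContDiff
open Bundle Set

noncomputable section

namespace NullMatching

/-! ## Pointwise algebra of metric hypersurface data

`E` plays the role of a tangent space `T_pN`, and `γ`, `l`, `l2` are the values at `p` of the tensors
`γ`, `ℓ`, `ℓ⁽²⁾`. -/

section Pointwise

variable {E : Type*} [NormedAddCommGroup E] [NormedSpace ℝ E]

/-- The symmetric bilinear form `𝒜((W,a),(Z,b)) = γ(W,Z) + a ℓ(Z) + b ℓ(W) + a b ℓ⁽²⁾` on
`T_pN × ℝ`. -/
def ambientForm (γ : E →L[ℝ] E →L[ℝ] ℝ) (l : E →L[ℝ] ℝ) (l2 : ℝ) :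
    (E × ℝ) →L[ℝ] (E × ℝ) →L[ℝ] ℝ :=
  γ.bilinearComp (ContinuousLinearMap.fst ℝ E ℝ) (ContinuousLinearMap.fst ℝ E ℝ)
    + (ContinuousLinearMap.mul ℝ ℝ).bilinearComp (ContinuousLinearMap.snd ℝ E ℝ)
        (l.comp (ContinuousLinearMap.fst ℝ E ℝ))
    + (ContinuousLinearMap.mul ℝ ℝ).bilinearComp (l.comp (ContinuousLinearMap.fst ℝ E ℝ))
        (ContinuousLinearMap.snd ℝ E ℝ)
    + l2 • (ContinuousLinearMap.mul ℝ ℝ).bilinearComp (ContinuousLinearMap.snd ℝ E ℝ)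
        (ContinuousLinearMap.snd ℝ E ℝ)

theorem ambientForm_apply (γ : E →L[ℝ] E →L[ℝ] ℝ) (l : E →L[ℝ] ℝ) (l2 : ℝ) (X Z : E × ℝ) :
    ambientForm γ l l2 X Z = γ X.1 Z.1 + X.2 * l Z.1 + Z.2 * l X.1 + X.2 * Z.2 * l2 := by
  simp [ambientForm]
  ring

/-- The vector `n`, read off from the inverse `𝒜⁻¹` (see `gamma_nVec`, `l_nVec` for its defining
equations). -/
def nVec (γ : E →L[ℝ] E →L[ℝ] ℝ) (l : E →L[ℝ] ℝ) (l2 : ℝ) : E :=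
  ((ambientForm γ l l2).inverse (ContinuousLinearMap.snd ℝ E ℝ)).1

/-- The scalar `n⁽²⁾`, read off from `𝒜⁻¹`. -/
def nScal (γ : E →L[ℝ] E →L[ℝ] ℝ) (l : E →L[ℝ] ℝ) (l2 : ℝ) : ℝ :=
  ((ambientForm γ l l2).inverse (ContinuousLinearMap.snd ℝ E ℝ)).2

/-- The vector `P(θ, ·)` obtained by contracting the symmetric 2-contravariant tensor `P` with the
covector `θ`, read off from `𝒜⁻¹`. -/
def pVec (γ : E →L[ℝ] E →L[ℝ] ℝ) (l : E →L[ℝ] ℝ) (l2 : ℝ) (θ : E →L[ℝ] ℝ) : E :=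
  ((ambientForm γ l l2).inverse (θ.comp (ContinuousLinearMap.fst ℝ E ℝ))).1

/-- Non-degeneracy of the form `𝒜`. -/
def AmbientNondegenerate (γ : E →L[ℝ] E →L[ℝ] ℝ) (l : E →L[ℝ] ℝ) (l2 : ℝ) : Prop :=
  ∀ X : E × ℝ, (∀ Z : E × ℝ, ambientForm γ l l2 X Z = 0) → X = 0

variable [FiniteDimensional ℝ E] {γ : E →L[ℝ] E →L[ℝ] ℝ} {l : E →L[ℝ] ℝ} {l2 : ℝ}

theorem AmbientNondegenerate.isInvertible (h : AmbientNondegenerate γ l l2) :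
    (ambientForm γ l l2).IsInvertible := by
  have hinj : Function.Injective (ambientForm γ l l2 : (E × ℝ) →ₗ[ℝ] ((E × ℝ) →L[ℝ] ℝ)) := by
    rw [← LinearMap.ker_eq_bot, LinearMap.ker_eq_bot']
    intro X hX
    exact h X fun Z => by
      have : ambientForm γ l l2 X = 0 := hX
      rw [this]; rfl
  have hdim : Module.finrank ℝ (E × ℝ) = Module.finrank ℝ ((E × ℝ) →L[ℝ] ℝ) := by
    rw [← (LinearMap.toContinuousLinearMap (𝕜 := ℝ) (E := E × ℝ) (F' := ℝ)).finrank_eq]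
    exact (Subspace.dual_finrank_eq (K := ℝ) (V := E × ℝ)).symm
  refine ⟨(LinearEquiv.ofInjectiveOfFinrankEq _ hinj hdim).toContinuousLinearEquiv, ?_⟩
  exact ContinuousLinearMap.ext fun X => rfl

theorem AmbientNondegenerate.apply_inverse (h : AmbientNondegenerate γ l l2)
    (f : (E × ℝ) →L[ℝ] ℝ) : ambientForm γ l l2 ((ambientForm γ l l2).inverse f) = f :=
  ((h.isInvertible.inverse_apply_eq).1 rfl).symm

/-- `γ_{ab} n^b + n⁽²⁾ ℓ_a = 0`. -/
theorem gamma_nVec (h : AmbientNondegenerate γ l l2) (w : E) :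
    γ (nVec γ l l2) w + nScal γ l l2 * l w = 0 := by
  have := DFunLike.congr_fun (h.apply_inverse (ContinuousLinearMap.snd ℝ E ℝ)) (w, 0)
  simpa [ambientForm_apply, nVec, nScal] using this

/-- `ℓ_a n^a + n⁽²⁾ ℓ⁽²⁾ = 1`. -/
theorem l_nVec (h : AmbientNondegenerate γ l l2) :
    l (nVec γ l l2) + nScal γ l l2 * l2 = 1 := by
  have := DFunLike.congr_fun (h.apply_inverse (ContinuousLinearMap.snd ℝ E ℝ)) (0, 1)
  simpa [ambientForm_apply, nVec, nScal] using this

theorem pVec_snd (hs : ∀ u w, γ u w = γ w u) (h : AmbientNondegenerate γ l l2)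
    (θ : E →L[ℝ] ℝ) :
    ((ambientForm γ l l2).inverse (θ.comp (ContinuousLinearMap.fst ℝ E ℝ))).2
      = θ (nVec γ l l2) := by
  set Y := (ambientForm γ l l2).inverse (θ.comp (ContinuousLinearMap.fst ℝ E ℝ)) with hY
  have h1 := DFunLike.congr_fun (h.apply_inverse (θ.comp (ContinuousLinearMap.fst ℝ E ℝ)))
    (nVec γ l l2, nScal γ l l2)
  have h2 := gamma_nVec h Y.1
  have h3 := l_nVec h
  rw [← hY] at h1
  simp [ambientForm_apply] at h1
  rw [hs] at h2
  linear_combination h1 - h2 - Y.2 * h3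

/-- `P^{ab} γ_{bc} + n^a ℓ_c = δ^a_c`, contracted with a covector `θ_a`. -/
theorem gamma_pVec (hs : ∀ u w, γ u w = γ w u) (h : AmbientNondegenerate γ l l2)
    (θ : E →L[ℝ] ℝ) (w : E) :
    γ (pVec γ l l2 θ) w + θ (nVec γ l l2) * l w = θ w := by
  have := DFunLike.congr_fun (h.apply_inverse (θ.comp (ContinuousLinearMap.fst ℝ E ℝ))) (w, 0)
  rw [← pVec_snd hs h θ]
  simpa [ambientForm_apply, pVec] using this

/-- `P^{ab} ℓ_b + ℓ⁽²⁾ n^a = 0`, contracted with a covector `θ_a`. -/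
theorem l_pVec (hs : ∀ u w, γ u w = γ w u) (h : AmbientNondegenerate γ l l2)
    (θ : E →L[ℝ] ℝ) :
    l (pVec γ l l2 θ) + l2 * θ (nVec γ l l2) = 0 := by
  have := DFunLike.congr_fun (h.apply_inverse (θ.comp (ContinuousLinearMap.fst ℝ E ℝ))) (0, 1)
  rw [← pVec_snd hs h θ]
  have e : l (pVec γ l l2 θ) + ((ambientForm γ l l2).inverse
      (θ.comp (ContinuousLinearMap.fst ℝ E ℝ))).2 * l2 = 0 := by
    simpa [ambientForm_apply, pVec] using this
  linear_combination e

end Pointwise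

set_option synthInstance.maxHeartbeats 400000 in
set_option maxHeartbeats 1000000 in
theorem hasMFDerivAt_eval {E : Type*} [NormedAddCommGroup E] [NormedSpace ℝ E]
    (a b : E) (S : E →L[ℝ] E →L[ℝ] ℝ) :
    HasMFDerivAt 𝓘(ℝ, E →L[ℝ] E →L[ℝ] ℝ) 𝓘(ℝ, ℝ) (fun S : E →L[ℝ] E →L[ℝ] ℝ => S a b) S
      ((ContinuousLinearMap.apply ℝ ℝ b).comp (ContinuousLinearMap.apply ℝ (E →L[ℝ] ℝ) a)) := by
  have h : HasFDerivAt (fun S : E →L[ℝ] E →L[ℝ] ℝ => S a b)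
      ((ContinuousLinearMap.apply ℝ ℝ b).comp (ContinuousLinearMap.apply ℝ (E →L[ℝ] ℝ) a)) S :=
    ((ContinuousLinearMap.apply ℝ ℝ b).comp
      (ContinuousLinearMap.apply ℝ (E →L[ℝ] ℝ) a)).hasFDerivAt
  exact (hasMFDerivAt_iff_hasFDerivAt).2 h

/-! ## Tensor fields, components in charts, Lie derivatives

In Mathlib the tangent space `T_xM` is the model space `E`, a vector being represented by its
components in the preferred chart at `x`; `tangentCoordChange I x y z` is the change of components
at `z` from the chart at `x` to the chart at `y`. -/

section Tensors

variable {E H : Type*} [NormedAddCommGroup E] [NormedSpace ℝ E] [TopologicalSpace H]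
variable (I : ModelWithCorners ℝ E H) (M : Type*) [TopologicalSpace M] [ChartedSpace H M]
  [IsManifold I ∞ M]

/-- Vector fields (no regularity). -/
abbrev VField := ∀ x : M, TangentSpace I x

/-- Covector fields (no regularity). -/
abbrev CovField := ∀ x : M, TangentSpace I x →L[ℝ] ℝ

/-- 2-covariant tensor fields (no regularity). -/
abbrev BilinField := ∀ x : M, TangentSpace I x →L[ℝ] TangentSpace I x →L[ℝ] ℝ

variable {I M}

/-- The differential `df` of a function. -/
def differential (f : M → ℝ) : CovField I M := fun x => mvfderiv I f x

/-- Components of a covector field `θ`, at the point `y`, in the chart around `x`. -/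
def covComponents (θ : CovField I M) (x y : M) : E →L[ℝ] ℝ :=
  ContinuousLinearMap.comp (θ y : E →L[ℝ] ℝ) (tangentCoordChange I x y y)

/-- Components `T_{ab}` of a 2-covariant tensor field, at the point `y`, in the chart around `x`. -/
def bilinComponents (T : BilinField I M) (x y : M) : E →L[ℝ] E →L[ℝ] ℝ :=
  ContinuousLinearMap.bilinearComp (E := E) (F := E) (T y)
    (tangentCoordChange I x y y) (tangentCoordChange I x y y)

/-- The partial derivatives `(u, w) ↦ u^a w^b ∂_a θ_b` at `x`, in the chart around `x`. -/
def partialCov (θ : CovField I M) (x : M) : E →L[ℝ] E →L[ℝ] ℝ :=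
  mvfderiv I (covComponents θ x) x

/-- The partial derivatives `(u, v, w) ↦ u^a v^b w^c ∂_a T_{bc}` at `x`, in the chart around `x`. -/
def partialBilin (T : BilinField I M) (x : M) : E →L[ℝ] E →L[ℝ] E →L[ℝ] ℝ :=
  mvfderiv I (bilinComponents T x) x

/-- Symmetrized tensor product `α ⊗_s β = ½ (α ⊗ β + β ⊗ α)` of covectors. -/
def symProd (α β : E →L[ℝ] ℝ) : E →L[ℝ] E →L[ℝ] ℝ :=
  (1 / 2 : ℝ) • (α.smulRight β + β.smulRight α)

/-- `(u, w) ↦ ½ (∂_a T_{bc} + ∂_b T_{ac} - ∂_c T_{ab}) u^a w^b`, a covector in the index `c`, at `x`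
in the chart around `x` (Christoffel symbols of the first kind). -/
def christoffelFirst (T : BilinField I M) (x : M) (u w : E) : E →L[ℝ] ℝ :=
  (1 / 2 : ℝ) • (partialBilin T x u w + partialBilin T x w u
    - ((partialBilin T x).flip u).flip w)

variable {E' H' : Type*} [NormedAddCommGroup E'] [NormedSpace ℝ E'] [TopologicalSpace H']
variable {J : ModelWithCorners ℝ E' H'} {N : Type*} [TopologicalSpace N] [ChartedSpace H' N]
  [IsManifold J ∞ N]

/-- Pull-back `f^⋆ θ` of a covector field. -/
def pullbackCov (f : N → M) (θ : CovField I M) : CovField J N := fun p =>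
  ContinuousLinearMap.comp (θ (f p)) (mfderiv J I f p)

/-- Pull-back `f^⋆ T` of a 2-covariant tensor field. -/
def pullbackBilin (f : N → M) (T : BilinField I M) : BilinField J N := fun p =>
  ContinuousLinearMap.bilinearComp (E := E) (F := E) (E' := E') (F' := E') (T (f p))
    (mfderiv J I f p) (mfderiv J I f p)

/-- For a vector field `ζ` of `M` along `f : N → M`, the derivatives `u ↦ u^i ∂_i ζ^a` at `p` of its
components in the chart of `M` around `f p`. -/
def partialAlong (f : N → M) (ζ : ∀ p : N, TangentSpace I (f p)) (p : N) : E' →L[ℝ] E :=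
  mvfderiv J (fun p' : N => (tangentCoordChange I (f p') (f p) (f p') (ζ p') : E)) p

/-- The pull-back `f^⋆(£_ζ T)` of the Lie derivative of a 2-covariant tensor field `T` of `M` along a
vector field `ζ` defined along `f`. In the chart of `M` around `f p`, the Lie derivative is
`ζ^c ∂_c T_{ab} + T_{cb} ∂_a ζ^c + T_{ac} ∂_b ζ^c`; contracted with the vectors `f_⋆ u`, `f_⋆ w` it
only contains derivatives of `ζ` tangent to `f`, so that it does not depend on an extension of `ζ`
off `f` (see `pullLie_restrict`). For `f = id` it is the usual Lie derivative. -/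
def pullLie (T : BilinField I M) (f : N → M) (ζ : ∀ p : N, TangentSpace I (f p)) :
    BilinField J N := fun p =>
  letI df : E' →L[ℝ] E := mfderiv J I f p
  letI dζ : E' →L[ℝ] E := partialAlong (J := J) f ζ p
  letI Tp : E →L[ℝ] E →L[ℝ] ℝ := T (f p)
  ((partialBilin T (f p) (ζ p)).bilinearComp df df + Tp.bilinearComp dζ df
    + Tp.bilinearComp df dζ : E' →L[ℝ] E' →L[ℝ] ℝ)

/-- The Lie derivative `£_X T` of a 2-covariant tensor field along a vector field. -/
def lieDeriv (T : BilinField I M) (X : VField I M) : BilinField I M :=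
  pullLie (J := I) T (id : M → M) X

/-- Smoothness of the components of a smooth vector field. -/
theorem vector_components {X : VField I M}
    (hX : ContMDiff I I.tangent ∞ (fun x => (⟨x, X x⟩ : TangentBundle I M))) (x : M) :
    ContMDiffAt I 𝓘(ℝ, E) ∞ (fun y => (tangentCoordChange I y x y (X y) : E)) x := by
  exact ((contMDiffAt_section (F := E) (E := (TangentSpace I : M → Type _)) x).1 (hX x))

/-- If `ζ` is the restriction to `f` of a smooth vector field `X` of `M`, then `pullLie` is the
pull-back of the Lie derivative along `X`. -/
theorem pullLie_restrict (T : BilinField I M) {X : VField I M}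
    (hX : ContMDiff I I.tangent ∞ (fun x => (⟨x, X x⟩ : TangentBundle I M)))
    {f : N → M} (p : N) (hf : MDifferentiableAt J I f p) :
    pullLie (J := J) T f (fun p => X (f p)) p = pullbackBilin f (lieDeriv T X) p := by
  have hXd : MDifferentiableAt I 𝓘(ℝ, E) (fun y => (tangentCoordChange I y (f p) y (X y) : E))
    (f p) := (vector_components hX (f p)).mdifferentiableAt (by simp)
  have key : partialAlong (J := J) f (fun p => X (f p)) p
      = (partialAlong (J := I) (id : M → M) X (f p)).comp (mfderiv J I f p : E' →L[ℝ] E) := by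
    ext u
    have := mfderiv_comp_apply p hXd hf u
    exact this
  refine ContinuousLinearMap.ext fun u => ContinuousLinearMap.ext fun w => ?_
  unfold pullLie
  rw [key]
  simp only [pullbackBilin, lieDeriv, pullLie]
  rw [mfderiv_id]
  rfl

end Tensors

/-! ## Connections -/

section Connections

variable {E H : Type*} [NormedAddCommGroup E] [NormedSpace ℝ E] [TopologicalSpace H]
variable {I : ModelWithCorners ℝ E H} {M : Type*} [TopologicalSpace M] [ChartedSpace H M]
  [IsManifold I ∞ M]

/-- The covariant derivative `u^a w^b ∇_a θ_b = u^a w^b (∂_a θ_b - Γ^c_{ab} θ_c)` at `x` of a covector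
field, in terms of the connection coefficients `Γ` at `x` in the chart around `x`. -/
def covariantDeriv (Γ : E → E → E) (θ : CovField I M) (x : M) (u w : E) : ℝ :=
  partialCov θ x u w - (θ x : E →L[ℝ] ℝ) (Γ u w)

/-- The Christoffel symbols `Γ(u,w)^c = ½ h^{cd} (∂_a h_{bd} + ∂_b h_{ad} - ∂_d h_{ab}) u^a w^b` at `x`
of the Levi-Civita connection of a (non-degenerate) metric `h`, in the chart around `x`. -/
def leviCivita (h : BilinField I M) (x : M) (u w : E) : E :=
  letI hx : E →L[ℝ] E →L[ℝ] ℝ := h x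
  hx.inverse (christoffelFirst h x u w)

/-- The Hessian `∇^h_u ∇^h_w f` at `x` for the Levi-Civita connection of the metric `h`. -/
def hessian (h : BilinField I M) (f : M → ℝ) (x : M) (u w : E) : ℝ :=
  covariantDeriv (leviCivita h x) (differential (I := I) f) x u w

end Connections

/-! ## Hypersurface data -/

section Data

variable {E H : Type*} [NormedAddCommGroup E] [NormedSpace ℝ E] [TopologicalSpace H]
variable (I : ModelWithCorners ℝ E H) (M : Type*) [TopologicalSpace M] [ChartedSpace H M]
  [IsManifold I ∞ M]

/-- Smoothness of a covector field. -/
def SmoothCov (θ : CovField I M) : Prop :=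
  ContMDiff I (I.prod 𝓘(ℝ, E →L[ℝ] ℝ)) ∞
    (fun x => TotalSpace.mk' (E →L[ℝ] ℝ) (E := fun x : M => TangentSpace I x →L[ℝ] ℝ) x (θ x))

/-- Smoothness of a 2-covariant tensor field. -/
def SmoothBilin (T : BilinField I M) : Prop :=
  ContMDiff I (I.prod 𝓘(ℝ, E →L[ℝ] E →L[ℝ] ℝ)) ∞
    (fun x => TotalSpace.mk' (E →L[ℝ] E →L[ℝ] ℝ)
      (E := fun x : M => TangentSpace I x →L[ℝ] TangentSpace I x →L[ℝ] ℝ) x (T x))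

variable {I M}

theorem SmoothCov.components {θ : CovField I M} (h : SmoothCov I M θ) (x : M) :
    ContMDiffAt I 𝓘(ℝ, E →L[ℝ] ℝ) ∞ (covComponents θ x) x := by
  have h1 := (contMDiffAt_hom_bundle _).1 (h x)
  refine h1.2.congr_of_eventuallyEq ?_
  filter_upwards [(chartAt H x).open_source.mem_nhds (mem_chart_source H x)] with y hy
  ext u
  simp only [covComponents, ContinuousLinearMap.inCoordinates, TangentBundle.symmL_trivializationAt_eq_core hy]
  simp

theorem cov_trivialization (x y : M) (hy : y ∈ (chartAt H x).source)
    (z : TangentSpace I y →L[ℝ] ℝ) (w : E) :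
    Trivialization.continuousLinearMapAt ℝ
      (trivializationAt (E →L[ℝ] ℝ) (fun b : M => TangentSpace I b →L[ℝ] ℝ) x) y z w
      = (z : E →L[ℝ] ℝ) (tangentCoordChange I x y y w) := by
  have hb : y ∈ (trivializationAt (E →L[ℝ] ℝ) (fun b : M => TangentSpace I b →L[ℝ] ℝ) x).baseSet :=
    ⟨hy, trivial⟩
  rw [Trivialization.continuousLinearMapAt_apply, Trivialization.coe_linearMapAt_of_mem _ hb]
  simp only [hom_trivializationAt_apply, ContinuousLinearMap.inCoordinates,
    TangentBundle.symmL_trivializationAt_eq_core hy]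
  simp
  rfl

theorem SmoothBilin.components {T : BilinField I M} (h : SmoothBilin I M T) (x : M) :
    ContMDiffAt I 𝓘(ℝ, E →L[ℝ] E →L[ℝ] ℝ) ∞ (bilinComponents T x) x := by
  have h1 := (contMDiffAt_hom_bundle _).1 (h x)
  refine h1.2.congr_of_eventuallyEq ?_
  filter_upwards [(chartAt H x).open_source.mem_nhds (mem_chart_source H x)] with y hy
  refine ContinuousLinearMap.ext fun u => ContinuousLinearMap.ext fun w => ?_
  simp only [ContinuousLinearMap.inCoordinates, TangentBundle.symmL_trivializationAt_eq_core hy]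
  exact (cov_trivialization x y hy _ w).symm

variable (I M)

/-- Metric hypersurface data `{N, γ, ℓ, ℓ⁽²⁾}`. -/
structure MetricHypersurfaceData where
  γ : BilinField I M
  l : CovField I M
  l2 : M → ℝ
  smooth_γ : SmoothBilin I M γ
  smooth_l : SmoothCov I M l
  smooth_l2 : ContMDiff I 𝓘(ℝ, ℝ) ∞ l2
  symm_γ : ∀ (p : M) (u w : TangentSpace I p), γ p u w = γ p w u
  nondegenerate : ∀ p : M, AmbientNondegenerate (E := E) (γ p) (l p) (l2 p)

/-- Hypersurface data `{N, γ, ℓ, ℓ⁽²⁾, Y}`. -/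
structure HypersurfaceData extends MetricHypersurfaceData I M where
  Y : BilinField I M
  smooth_Y : SmoothBilin I M Y
  symm_Y : ∀ (p : M) (u w : TangentSpace I p), Y p u w = Y p w u

variable {I M}

set_option synthInstance.maxHeartbeats 400000 in
set_option maxHeartbeats 1000000 in
/-- The derivatives of a smooth symmetric tensor field are symmetric. -/
theorem partialBilin_symm {T : BilinField I M} (hT : SmoothBilin I M T)
    (hs : ∀ (p : M) (u w : TangentSpace I p), T p u w = T p w u) (p : M) (v u w : E) :
    partialBilin T p v u w = partialBilin T p v w u := by
  have hd : MDifferentiableAt I 𝓘(ℝ, E →L[ℝ] E →L[ℝ] ℝ) (bilinComponents T p) p :=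
    (hT.components p).mdifferentiableAt (by simp)
  have key : ∀ a b : E, partialBilin T p v a b
      = mvfderiv I (fun y => bilinComponents T p y a b) p v := by
    intro a b
    have h1 := hasMFDerivAt_eval a b (bilinComponents T p p)
    have h2 := DFunLike.congr_fun (h1.comp p hd.hasMFDerivAt).mfderiv v
    exact h2.symm
  rw [key, key]
  congr 2
  funext y
  exact hs y _ _

namespace MetricHypersurfaceData

variable (D : MetricHypersurfaceData I M)

/-- The vector field `n`. -/
def n : VField I M := fun p => nVec (E := E) (D.γ p) (D.l p) (D.l2 p)

/-- The function `n⁽²⁾`. -/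
def n2 : M → ℝ := fun p => nScal (E := E) (D.γ p) (D.l p) (D.l2 p)

/-- The vector `P(θ, ·)` at `p`. -/
def P (p : M) (θ : TangentSpace I p →L[ℝ] ℝ) : TangentSpace I p :=
  pVec (E := E) (D.γ p) (D.l p) (D.l2 p) θ

/-- The data is null: `n⁽²⁾ = 0` everywhere. -/
def IsNull : Prop := ∀ p, D.n2 p = 0

/-- `F = ½ dℓ`, at `p` in the chart around `p`. -/
def F (p : M) (u w : E) : ℝ := (1 / 2) * (partialCov D.l p u w - partialCov D.l p w u)

/-- `U = ½ £_n γ + ℓ ⊗_s dn⁽²⁾`. -/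
def U : BilinField I M := fun p =>
  letI lieγ : E →L[ℝ] E →L[ℝ] ℝ := lieDeriv D.γ D.n p
  (1 / 2 : ℝ) • lieγ + symProd (E := E) (D.l p) (differential (I := I) D.n2 p)

/-- The coefficients, at `p` in the chart around `p`, of the metric hypersurface connection `∇°`:
`Γ^c_{ab} = ½ P^{cd} (∂_a γ_{bd} + ∂_b γ_{ad} - ∂_d γ_{ab}) + ½ n^c (∂_a ℓ_b + ∂_b ℓ_a)`. These are the
coefficients of the unique torsion-free connection with
`∇°_a γ_{bc} = - ℓ_b U_{ac} - ℓ_c U_{ab}` and `∇°_a ℓ_b = F_{ab} - ℓ⁽²⁾ U_{ab}`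
(see `eq_connection`). -/
def connection (p : M) (u w : E) : E :=
  pVec (E := E) (D.γ p) (D.l p) (D.l2 p) (christoffelFirst D.γ p u w)
    + ((1 / 2) * (partialCov D.l p u w + partialCov D.l p w u)) •
      nVec (E := E) (D.γ p) (D.l p) (D.l2 p)

theorem U_apply (p : M) (u w : E) : D.U p u w =
    (1 / 2) * (partialBilin D.γ p (D.n p) u w
      + D.γ p (partialAlong (J := I) (id : M → M) D.n p u) w
      + D.γ p u (partialAlong (J := I) (id : M → M) D.n p w))
    + (1 / 2) * (D.l p u * differential (I := I) D.n2 p w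
      + differential (I := I) D.n2 p u * D.l p w) := by
  have h : ∀ a : E, mfderiv I I (id : M → M) p a = a := fun a => by rw [mfderiv_id]; rfl
  have e : D.U p u w = (1 / 2) * (partialBilin D.γ p (D.n p) (mfderiv I I (id : M → M) p u)
        (mfderiv I I (id : M → M) p w)
      + D.γ p (partialAlong (J := I) (id : M → M) D.n p u) (mfderiv I I (id : M → M) p w)
      + D.γ p (mfderiv I I (id : M → M) p u) (partialAlong (J := I) (id : M → M) D.n p w))
    + (1 / 2) * (D.l p u * differential (I := I) D.n2 p w
      + differential (I := I) D.n2 p u * D.l p w) := rfl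
  rw [e]
  erw [h u, h w]

theorem U_symm (p : M) (u w : E) : D.U p u w = D.U p w u := by
  have h : ∀ v a b : E, partialBilin D.γ p v a b = partialBilin D.γ p v b a :=
    partialBilin_symm D.smooth_γ D.symm_γ p
  have hs : ∀ a b : E, D.γ p a b = D.γ p b a := D.symm_γ p
  rw [U_apply, U_apply, h (D.n p) u w, hs u, hs _ w]
  ring

/-- Uniqueness of the metric hypersurface connection: coefficients `Γ` without torsion that satisfy
its two defining equations coincide with those of `connection`. -/
theorem eq_connection [FiniteDimensional ℝ E] (p : M) (Γ : E → E → E)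
    (htor : ∀ u w, Γ u w = Γ w u)
    (hγ : ∀ u v w : E, partialBilin D.γ p u v w - D.γ p (Γ u v) w - D.γ p v (Γ u w)
      = - D.l p v * D.U p u w - D.l p w * D.U p u v)
    (hl : ∀ u v : E, covariantDeriv Γ D.l p u v = D.F p u v - D.l2 p * D.U p u v) (u w : E) :
    Γ u w = D.connection p u w := by
  have hU := D.U_symm p
  have hs : ∀ a b : E, D.γ p a b = D.γ p b a := D.symm_γ p
  have e1 : ∀ v : E, D.γ p (Γ u w) v - D.U p u w * D.l p v = christoffelFirst D.γ p u w v := by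
    intro v
    have h1 := hγ u w v
    have h2 := hγ w u v
    have h3 := hγ v u w
    rw [hs w (Γ u v)] at h1
    rw [hs u (Γ w v), htor w u, hU w u] at h2
    rw [hs u (Γ v w), htor v u, htor v w, hU v u, hU v w] at h3
    simp only [christoffelFirst]
    simp
    linear_combination (-1 / 2) * h1 - (1 / 2) * h2 + (1 / 2) * h3
  have e2 : D.l p (Γ u w) - D.U p u w * D.l2 p
      = (1 / 2) * (partialCov D.l p u w + partialCov D.l p w u) := by
    have := hl u w
    simp only [covariantDeriv, F] at this
    linear_combination - this
  set A := ambientForm (E := E) (D.γ p) (D.l p) (D.l2 p) with hA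
  have hinv := (D.nondegenerate p).isInvertible
  have hX : A.inverse ((christoffelFirst D.γ p u w).comp (ContinuousLinearMap.fst ℝ E ℝ)
      + ((1 / 2) * (partialCov D.l p u w + partialCov D.l p w u)) • ContinuousLinearMap.snd ℝ E ℝ)
      = (Γ u w, - D.U p u w) := by
    rw [hinv.inverse_apply_eq]
    refine ContinuousLinearMap.ext fun Z => ?_
    have h1 := e1 Z.1
    have h2 : A (Γ u w, - D.U p u w) Z = _ := ambientForm_apply _ _ _ _ _
    change christoffelFirst D.γ p u w Z.1
      + ((1 / 2) * (partialCov D.l p u w + partialCov D.l p w u)) * Z.2 = _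
    refine Eq.trans ?_ h2.symm
    dsimp only
    linear_combination - h1 - Z.2 * e2
  rw [map_add, map_smul] at hX
  exact (congrArg Prod.fst hX).symm

/-- `∇°_u ∇°_w f` at `p`. -/
def hessian (f : M → ℝ) (p : M) (u w : E) : ℝ :=
  covariantDeriv (D.connection p) (differential (I := I) f) p u w

end MetricHypersurfaceData

end Data

/-! ## Spacetimes, embedded data, foliated null boundaries, matching -/

section Matching

variable {E H : Type*} [NormedAddCommGroup E] [NormedSpace ℝ E] [TopologicalSpace H]
variable {E' H' : Type*} [NormedAddCommGroup E'] [NormedSpace ℝ E'] [TopologicalSpace H']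

/-- A smooth Lorentzian metric, of signature `(-,+,…,+)`. -/
structure LorentzMetric (I : ModelWithCorners ℝ E H) (M : Type*) [TopologicalSpace M]
    [ChartedSpace H M] [IsManifold I ∞ M] where
  g : BilinField I M
  smooth : SmoothBilin I M g
  symm : ∀ (q : M) (u w : TangentSpace I q), g q u w = g q w u
  signature : ∀ q : M, ∃ t : TangentSpace I q, g q t t < 0 ∧
    ∀ u : TangentSpace I q, g q t u = 0 → u ≠ 0 → 0 < g q u u

variable {I : ModelWithCorners ℝ E H} {M : Type*} [TopologicalSpace M] [ChartedSpace H M]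
  [IsManifold I ∞ M]
variable {J : ModelWithCorners ℝ E' H'} {N : Type*} [TopologicalSpace N] [ChartedSpace H' N]
  [IsManifold J ∞ N]

/-- `ζ` is a rigging along the hypersurface `f : N → M`: a smooth vector field along `f`, everywhere
transversal to it. -/
structure IsRigging (f : N → M) (ζ : ∀ p : N, TangentSpace I (f p)) : Prop where
  smooth : ContMDiff J I.tangent ∞ (fun p => (⟨f p, ζ p⟩ : TangentBundle I M))
  transversal : ∀ (p : N) (u : TangentSpace J p), mfderiv J I f p u ≠ ζ p

/-- The hypersurface data `D` is embedded in `(M, g)` with embedding `f` and rigging `ζ`. -/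
structure IsEmbeddedData (D : HypersurfaceData J N) (g : LorentzMetric I M) (f : N → M)
    (ζ : ∀ p : N, TangentSpace I (f p)) : Prop where
  embedding : Manifold.IsSmoothEmbedding J I ∞ f
  rigging : IsRigging (J := J) f ζ
  γ_eq : D.γ = pullbackBilin f g.g
  l_eq : ∀ (p : N) (u : TangentSpace J p), D.l p u = g.g (f p) (ζ p) (mfderiv J I f p u)
  l2_eq : ∀ p : N, D.l2 p = g.g (f p) (ζ p) (ζ p)
  Y_eq : ∀ p : N, D.Y p = (1 / 2 : ℝ) • pullLie (J := J) g.g f ζ p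

/-- `k` is a null generator (nowhere zero, tangent and normal to the hypersurface `f(N)`), `v` is a
foliation function with `k(v) = 1`, and the rigging `L` is null, orthogonal to the leaves
`{v = const}` and scaled by `g(L, k) = 1`. Only the values of `v` on `f(N)` matter. -/
structure IsFoliatedGauge (g : LorentzMetric I M) (f : N → M) (L k : ∀ p : N, TangentSpace I (f p))
    (v : M → ℝ) : Prop where
  smooth_v : ContMDiff J 𝓘(ℝ, ℝ) ∞ (v ∘ f)
  k_ne_zero : ∀ p, k p ≠ 0
  k_tangent : ∀ p, ∃ X : TangentSpace J p, mfderiv J I f p X = k p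
  k_normal : ∀ (p : N) (u : TangentSpace J p), g.g (f p) (k p) (mfderiv J I f p u) = 0
  k_v : ∀ (p : N) (X : TangentSpace J p), mfderiv J I f p X = k p →
    differential (I := J) (v ∘ f) p X = 1
  L_null : ∀ p, g.g (f p) (L p) (L p) = 0
  L_orthogonal : ∀ (p : N) (u : TangentSpace J p), differential (I := J) (v ∘ f) p u = 0 →
    g.g (f p) (L p) (mfderiv J I f p u) = 0
  L_k : ∀ p, g.g (f p) (L p) (k p) = 1

/-- The gauge transformation with parameters `(z, V)` maps the metric hypersurface data
`φ^⋆ D̂` to `D`: `φ^⋆ γ̂ = γ`, `z (φ^⋆ ℓ̂ + (φ^⋆ γ̂)(V, ·)) = ℓ` and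
`z² (φ^⋆ ℓ̂⁽²⁾ + 2 (φ^⋆ ℓ̂)(V) + (φ^⋆ γ̂)(V, V)) = ℓ⁽²⁾`, where `z` is a nowhere vanishing smooth
function and `V` a smooth vector field. -/
structure IsGaugeMatching (D D' : MetricHypersurfaceData J N) (φ : N → N) (z : N → ℝ)
    (V : VField J N) : Prop where
  smooth_z : ContMDiff J 𝓘(ℝ, ℝ) ∞ z
  z_ne_zero : ∀ p, z p ≠ 0
  smooth_V : ContMDiff J J.tangent ∞ (fun p => (⟨p, V p⟩ : TangentBundle J N))
  γ_eq : pullbackBilin φ D'.γ = D.γ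
  l_eq : ∀ (p : N) (u : TangentSpace J p),
    z p * (pullbackCov (J := J) φ D'.l p u + pullbackBilin (J := J) φ D'.γ p (V p) u) = D.l p u
  l2_eq : ∀ p : N, z p ^ 2 * (D'.l2 (φ p) + 2 * pullbackCov (J := J) φ D'.l p (V p)
    + pullbackBilin (J := J) φ D'.γ p (V p) (V p)) = D.l2 p

/-- The matching rigging `z (L + f_⋆ φ_⋆ V)`, as a vector field along `f ∘ φ`. -/
def matchingRigging (f : N → M) (L : ∀ p : N, TangentSpace I (f p)) (φ : N → N) (z : N → ℝ)
    (V : VField J N) : ∀ p : N, TangentSpace I ((f ∘ φ) p) := fun p =>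
  z p • (L (φ p) + mfderiv J I f (φ p) (mfderiv J J φ p (V p)))

/-- The vectors `e_A ∈ T_pN` complete `n` to a basis adapted to the foliation `{lam = const}`, that
is, `{n, e_A}` is a basis and `e_A(lam) = 0`. -/
def IsAdaptedFrame {m : ℕ} (D : MetricHypersurfaceData J N) (lam : N → ℝ) (p : N)
    (e : Fin m → TangentSpace J p) : Prop :=
  LinearIndependent ℝ (Fin.cons (D.n p) e : Fin (m + 1) → TangentSpace J p) ∧
  Submodule.span ℝ (range (Fin.cons (D.n p) e : Fin (m + 1) → TangentSpace J p)) = ⊤ ∧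
  ∀ A, differential (I := J) lam p (e A) = 0

/-- The inverse `h^{AB}` of the matrix `h_{AB} = γ(e_A, e_B)`. -/
def invMetric {m : ℕ} (D : MetricHypersurfaceData J N) (p : N) (e : Fin m → TangentSpace J p) :
    Matrix (Fin m) (Fin m) ℝ :=
  (Matrix.of fun A B => D.γ p (e A) (e B))⁻¹

end Matching

end NullMatching

end

open NullMatching

noncomputable section

namespace NullMatching

set_option linter.unusedSectionVars false

/-! The foliated gauges make the data very simple: the generator `k` is the image of `n`, so the
covector dual to the null rigging is exact, `ℓ = dλ` and `ℓ̂ = dv`, while both `ℓ⁽²⁾` vanish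
(`IsFoliatedGauge.l_eq`). Hence `φ^⋆ ℓ̂ = dH`, and the matching conditions read `z (dH + γ(V, ·)) =
ℓ` and `2 dH(V) + γ(V, V) = 0`. Since `γ(n, ·) = 0` and `ℓ(n) = 1`, evaluation on `n` gives `z n(H)
= 1`; writing `c = n(H)`, what remains is `γ(V, ·) = c ℓ - dH` and `dH(V) = -c ℓ(V)`
(`IsGaugeMatching.gauge_equations`). A vector is determined by its `γ`-products with the `e_A` and
its `ℓ`-value, which yields the formula for `V` (`IsTransverseFrame.gaugeVector`).

The rigging is `z` times the sum of the reparametrised `L⁺` and a tangential field. The Leibniz rule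
and naturality of the Lie derivative give `Y⁺ = z (φ^⋆ Ŷ⁺ + ½ £_V γ) + dz ⊗_s c ℓ`. Expanding in a
chart with `γ(V, ·) = c ℓ - dH`, and contracting the coefficients of `∇°` with the same covector,
gives `½ £_V γ = dc ⊗_s ℓ + ℓ(V) U - ∇°∇°H`. The terms in `dz` and `dc` cancel because `z c = 1`.
This is `half_pullLie_matchingRigging`, the core of the proof.

The components need four more facts: `φ_⋆ n = n(H) n̂` (`pushforward_n`); `U(·, n) = 0`
(`IsNull.U_n`); `∇°∇°H(·, n) = d(n(H)) + U(·, V)` (`IsNull.hessian_n`); and a Gauss formula saying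
that `∇°∇°H` restricts to the Hessian of the induced metric on the leaves (`hessian_leaf`).

All tensor calculus is done with partial derivatives at one point in its preferred chart.
`HasChartDeriv` carries the product and chain rules, and its uniqueness turns two ways of
differentiating one function into an identity. -/

instance bilinNormedAddCommGroup {A B C : Type*} [NormedAddCommGroup A] [NormedSpace ℝ A]
    [NormedAddCommGroup B] [NormedSpace ℝ B] [NormedAddCommGroup C] [NormedSpace ℝ C] :
    NormedAddCommGroup (A →L[ℝ] B →L[ℝ] C) :=
  ContinuousLinearMap.toNormedAddCommGroup

instance bilinNormedSpace {A B C : Type*} [NormedAddCommGroup A] [NormedSpace ℝ A]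
    [NormedAddCommGroup B] [NormedSpace ℝ B] [NormedAddCommGroup C] [NormedSpace ℝ C] :
    NormedSpace ℝ (A →L[ℝ] B →L[ℝ] C) :=
  ContinuousLinearMap.toNormedSpace

/-! ## Derivatives in the preferred chart -/

section ChartDeriv

variable {E H : Type*} [NormedAddCommGroup E] [NormedSpace ℝ E] [TopologicalSpace H]
variable {I : ModelWithCorners ℝ E H} {M : Type*} [TopologicalSpace M] [ChartedSpace H M]
variable {G : Type*} [NormedAddCommGroup G] [NormedSpace ℝ G]
variable {G' : Type*} [NormedAddCommGroup G'] [NormedSpace ℝ G']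

variable (I) in
/-- The representative of `s` in the preferred chart at `x` has derivative `D` at `x`. -/
def HasChartDeriv (s : M → G) (x : M) (D : E →L[ℝ] G) : Prop :=
  HasFDerivWithinAt (s ∘ (extChartAt I x).symm) D (range I) (extChartAt I x x)

namespace HasChartDeriv

/-- The target is a vector space, whose chart is the identity, so the manifold derivative is
literally the derivative of the chart representative. -/
theorem of_mdifferentiableAt {s : M → G} {x : M} (h : MDifferentiableAt I 𝓘(ℝ, G) s x) :
    HasChartDeriv I s x (mvfderiv I s x) := by
  have h1 := h.hasMFDerivAt.2
  exact h1

theorem mdifferentiableAt [IsManifold I ∞ M] {s : M → G} {x : M} {D : E →L[ℝ] G}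
    (h : HasChartDeriv I s x D) : MDifferentiableAt I 𝓘(ℝ, G) s x := by
  have : IsManifold I 1 M := IsManifold.of_le (n := ∞) (by simp)
  rw [← mdifferentiableWithinAt_univ]
  refine DifferentiableWithinAt.mdifferentiableWithinAt_of_comp_extChartAt_symm ?_
  simpa using h.differentiableWithinAt

/-- The range of a model with corners has unique derivatives even at boundary points. Identities
between partial derivatives are obtained below by differentiating one function in two ways and
comparing. -/
theorem unique {s : M → G} {x : M} {D D' : E →L[ℝ] G}
    (h : HasChartDeriv I s x D) (h' : HasChartDeriv I s x D') : D = D' :=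
  (I.uniqueDiffOn _ (mem_range_self _)).eq h h'

theorem mvfderiv_eq [IsManifold I ∞ M] {s : M → G} {x : M} {D : E →L[ℝ] G}
    (h : HasChartDeriv I s x D) : mvfderiv I s x = D :=
  (of_mdifferentiableAt h.mdifferentiableAt).unique h

theorem eventually_comp_symm {x : M} {P : M → Prop} (h : ∀ᶠ y in nhds x, P y) :
    ∀ᶠ y in nhds (extChartAt I x x), P ((extChartAt I x).symm y) := by
  have h1 := continuousAt_extChartAt_symm (I := I) x
  have h2 : Filter.Tendsto (extChartAt I x).symm (nhds (extChartAt I x x)) (nhds x) := by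
    simpa [ContinuousAt] using h1
  exact h2.eventually h

theorem congr {s t : M → G} {x : M} {D : E →L[ℝ] G} (h : HasChartDeriv I s x D)
    (hst : ∀ᶠ y in nhds x, t y = s y) : HasChartDeriv I t x D := by
  refine HasFDerivWithinAt.congr_of_eventuallyEq h
    (Filter.Eventually.filter_mono nhdsWithin_le_nhds (eventually_comp_symm hst)) ?_
  simpa using hst.self_of_nhds

theorem add {s t : M → G} {x : M} {D D' : E →L[ℝ] G} (h : HasChartDeriv I s x D)
    (h' : HasChartDeriv I t x D') : HasChartDeriv I (fun y => s y + t y) x (D + D') :=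
  HasFDerivWithinAt.add h h'

theorem sub {s t : M → G} {x : M} {D D' : E →L[ℝ] G} (h : HasChartDeriv I s x D)
    (h' : HasChartDeriv I t x D') : HasChartDeriv I (fun y => s y - t y) x (D - D') :=
  HasFDerivWithinAt.sub h h'

theorem smul {a : M → ℝ} {s : M → G} {x : M} {A : E →L[ℝ] ℝ} {D : E →L[ℝ] G}
    (ha : HasChartDeriv I a x A) (h : HasChartDeriv I s x D) :
    HasChartDeriv I (fun y => a y • s y) x (a x • D + A.smulRight (s x)) := by
  have := HasFDerivWithinAt.smul ha h
  simpa [HasChartDeriv, Function.comp_def] using! this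

theorem clm_apply {c : M → G →L[ℝ] G'} {s : M → G} {x : M} {C : E →L[ℝ] G →L[ℝ] G'}
    {D : E →L[ℝ] G} (hc : HasChartDeriv I c x C) (h : HasChartDeriv I s x D) :
    HasChartDeriv I (fun y => c y (s y)) x ((c x).comp D + C.flip (s x)) := by
  have := HasFDerivWithinAt.clm_apply hc h
  simpa [HasChartDeriv, Function.comp_def] using! this

theorem comp_hasFDerivAt {s : M → G} {x : M} {D : E →L[ℝ] G} {Φ : G → G'} {D' : G →L[ℝ] G'}
    (h : HasChartDeriv I s x D) (hΦ : HasFDerivAt Φ D' (s x)) :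
    HasChartDeriv I (fun y => Φ (s y)) x (D'.comp D) := by
  have e : (extChartAt I x).symm (extChartAt I x x) = x := by simp
  refine HasFDerivAt.comp_hasFDerivWithinAt (f := s ∘ (extChartAt I x).symm) _ ?_ h
  rwa [Function.comp_apply, e]

theorem clm_comp {G₁ : Type*} [NormedAddCommGroup G₁] [NormedSpace ℝ G₁] {c : M → G →L[ℝ] G'}
    {d : M → G₁ →L[ℝ] G} {x : M} {C : E →L[ℝ] G →L[ℝ] G'} {D : E →L[ℝ] G₁ →L[ℝ] G}
    (hc : HasChartDeriv I c x C) (hd : HasChartDeriv I d x D) :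
    HasChartDeriv I (fun y => (c y).comp (d y)) x
      ((ContinuousLinearMap.compL ℝ G₁ G G' (c x)).comp D
        + ((ContinuousLinearMap.compL ℝ G₁ G G').flip (d x)).comp C) := by
  have := HasFDerivWithinAt.clm_comp hc hd
  simpa [HasChartDeriv, Function.comp_def] using! this

theorem flip {G₁ : Type*} [NormedAddCommGroup G₁] [NormedSpace ℝ G₁] {c : M → G →L[ℝ] G₁ →L[ℝ] G'}
    {x : M} {C : E →L[ℝ] G →L[ℝ] G₁ →L[ℝ] G'} (hc : HasChartDeriv I c x C) :
    HasChartDeriv I (fun y => (c y).flip) x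
      (((ContinuousLinearMap.flipₗᵢ ℝ G G₁ G').toContinuousLinearEquiv.toContinuousLinearMap).comp
        C) :=
  hc.comp_hasFDerivAt (ContinuousLinearMap.flipₗᵢ ℝ G G₁ G').toContinuousLinearEquiv.hasFDerivAt

theorem const (a : G) (x : M) : HasChartDeriv I (fun _ : M => a) x (0 : E →L[ℝ] G) :=
  hasFDerivWithinAt_const _ _ _

end HasChartDeriv

variable {E' H' : Type*} [NormedAddCommGroup E'] [NormedSpace ℝ E'] [TopologicalSpace H']
variable {J : ModelWithCorners ℝ E' H'} {N : Type*} [TopologicalSpace N] [ChartedSpace H' N]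

theorem HasChartDeriv.comp_mdifferentiableAt [IsManifold I ∞ M] {s : M → G} {F : N → M} {p : N} {D : E →L[ℝ] G}
    (h : HasChartDeriv I s (F p) D) (hF : MDifferentiableAt J I F p) :
    HasChartDeriv J (fun y => s (F y)) p (D.comp (mfderiv J I F p : E' →L[ℝ] E)) := by
  have h1 : HasMFDerivAt J 𝓘(ℝ, G) (s ∘ F) p _ :=
    h.mdifferentiableAt.hasMFDerivAt.comp p hF.hasMFDerivAt
  have h2 : HasChartDeriv J (fun y => s (F y)) p
    ((mvfderiv I s (F p)).comp (mfderiv J I F p : E' →L[ℝ] E)) := h1.2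
  rwa [h.mvfderiv_eq] at h2

end ChartDeriv

/-! ## The second derivative of a map between manifolds -/

section SecondDeriv

variable {E H : Type*} [NormedAddCommGroup E] [NormedSpace ℝ E] [TopologicalSpace H]
variable {I : ModelWithCorners ℝ E H} {M : Type*} [TopologicalSpace M] [ChartedSpace H M]
  [IsManifold I ∞ M]
variable {E' H' : Type*} [NormedAddCommGroup E'] [NormedSpace ℝ E'] [TopologicalSpace H']
variable {J : ModelWithCorners ℝ E' H'} {N : Type*} [TopologicalSpace N] [ChartedSpace H' N]
  [IsManifold J ∞ N]

variable (I J) in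
/-- The differential of `F` at `p`, between the model spaces. -/
def pushforward (F : N → M) (p : N) : E' →L[ℝ] E := mfderiv J I F p

variable (I J) in
/-- The differential of `F` at `p'`, in the charts around `p` and `F p`. -/
def coordDeriv (F : N → M) (p p' : N) : E' →L[ℝ] E :=
  (tangentCoordChange I (F p') (F p) (F p')).comp
    ((mfderiv J I F p' : E' →L[ℝ] E).comp (tangentCoordChange J p p' p'))

variable (I J) in
/-- The second derivatives of `F` at `p`, in the charts around `p` and `F p`. -/
def secondDeriv (F : N → M) (p : N) : E' →L[ℝ] E' →L[ℝ] E :=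
  mvfderiv J (coordDeriv I J F p) p

theorem tangentCoordChange_self' (x : M) (v : E) : tangentCoordChange I x x x v = v :=
  tangentCoordChange_self (mem_extChartAt_source x)

theorem coordDeriv_self (F : N → M) (p : N) (u : E') :
    coordDeriv I J F p p u = pushforward I J F p u := by
  change tangentCoordChange I (F p) (F p) (F p)
    (pushforward I J F p (tangentCoordChange J p p p u)) = _
  rw [tangentCoordChange_self', tangentCoordChange_self']

theorem eventually_coordDeriv_eq {F : N → M} {p : N} (hF : ContinuousAt F p) :
    ∀ᶠ p' in nhds p, coordDeriv I J F p p' = inTangentCoordinates J I id F (mfderiv J I F) p p' := by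
  filter_upwards [(chartAt H' p).open_source.mem_nhds (mem_chart_source H' p),
    hF.preimage_mem_nhds ((chartAt H (F p)).open_source.mem_nhds (mem_chart_source H (F p)))]
    with p' h1 h2
  exact (inTangentCoordinates_eq id F (mfderiv J I F) h1 h2).symm

/-- Near `p` the coordinate expression agrees with `inTangentCoordinates` of the differential, which
is `C¹` because taking the differential costs one order. -/
theorem hasChartDeriv_coordDeriv {F : N → M} {p : N} (hF : ContMDiffAt J I ∞ F p) :
    HasChartDeriv J (coordDeriv I J F p) p (secondDeriv I J F p) := by
  have two_le : (1 + 1 : ℕ∞ω) ≤ ∞ := by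
    rw [one_add_one_eq_two]; exact WithTop.coe_le_coe.2 le_top
  have h1 : ContMDiffAt J 𝓘(ℝ, E' →L[ℝ] E) 1
    (inTangentCoordinates J I id F (mfderiv J I F) p) p := by
      have : IsManifold I (1 + 1) M := IsManifold.of_le (n := ∞) two_le
      have : IsManifold J (1 + 1) N := IsManifold.of_le (n := ∞) two_le
      exact ContMDiffAt.mfderiv_const (n := 1 + 1) (hF.of_le two_le) (le_refl _)
  have h2 := (HasChartDeriv.of_mdifferentiableAt (h1.mdifferentiableAt (by simp))).congr
    (eventually_coordDeriv_eq hF.continuousAt)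
  rw [secondDeriv, h2.mvfderiv_eq]
  exact h2

end SecondDeriv

/-! ### Symmetry of second derivatives on a boundaryless source. -/

section Symmetry

variable {E H : Type*} [NormedAddCommGroup E] [NormedSpace ℝ E] [TopologicalSpace H]
variable {I : ModelWithCorners ℝ E H} {M : Type*} [TopologicalSpace M] [ChartedSpace H M]
  [IsManifold I ∞ M]
variable {E' : Type*} [NormedAddCommGroup E'] [NormedSpace ℝ E']
variable {N : Type*} [TopologicalSpace N] [ChartedSpace E' N] [IsManifold 𝓘(ℝ, E') ∞ N]

/-- On a boundaryless source the chart representative of `F` is differentiable in the full sense at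
nearby points, and the coordinate changes in `coordDeriv` are the derivatives of the two charts.
This reduces symmetry to calculus in vector spaces. -/
theorem coordDeriv_eq_fderiv {F : N → M} (hF : ContMDiff 𝓘(ℝ, E') I ∞ F) (p : N) :
    ∀ᶠ p' in nhds p, coordDeriv I 𝓘(ℝ, E') F p p'
      = fderiv ℝ (extChartAt I (F p) ∘ F ∘ (extChartAt 𝓘(ℝ, E') p).symm) (extChartAt 𝓘(ℝ, E') p p') := by
  have : IsManifold I 1 M := IsManifold.of_le (n := ∞) (by exact_mod_cast le_top)
  have : IsManifold 𝓘(ℝ, E') 1 N := IsManifold.of_le (n := ∞) (by exact_mod_cast le_top)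
  filter_upwards [(chartAt E' p).open_source.mem_nhds (mem_chart_source E' p),
    hF.continuous.continuousAt.preimage_mem_nhds
      ((chartAt H (F p)).open_source.mem_nhds (mem_chart_source H (F p))),
    eventually_coordDeriv_eq (J := 𝓘(ℝ, E')) (I := I) hF.continuous.continuousAt]
    with p' h1 h2 h3
  rw [h3, inTangentCoordinates_eq_mfderiv_comp (f := id) h1 h2]
  have hp' : (extChartAt 𝓘(ℝ, E') p).symm (extChartAt 𝓘(ℝ, E') p p') = p' :=
    (extChartAt 𝓘(ℝ, E') p).left_inv (by rwa [extChartAt_source])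
  have a1 : MDifferentiableAt I 𝓘(ℝ, E) (extChartAt I (F p)) (F p') := mdifferentiableAt_extChartAt h2
  have a2 : MDifferentiableAt 𝓘(ℝ, E') I F p' := (hF p').mdifferentiableAt (by simp)
  have a3 : MDifferentiableAt 𝓘(ℝ, E') 𝓘(ℝ, E') (extChartAt 𝓘(ℝ, E') p).symm
      (extChartAt 𝓘(ℝ, E') p p') := by
    have := mdifferentiableWithinAt_extChartAt_symm (I := 𝓘(ℝ, E')) (x := p)
      ((extChartAt 𝓘(ℝ, E') p).map_source (by rwa [extChartAt_source] : p' ∈ _))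
    rw [modelWithCornersSelf_coe, range_id] at this
    exact this.mdifferentiableAt Filter.univ_mem
  have b := (a1.hasMFDerivAt.comp p' a2.hasMFDerivAt)
  set A : E →L[ℝ] E := mfderiv I 𝓘(ℝ, E) (extChartAt I (F p)) (F p')
  set B : E' →L[ℝ] E := mfderiv 𝓘(ℝ, E') I F p'
  have b' : HasMFDerivAt 𝓘(ℝ, E') 𝓘(ℝ, E) (extChartAt I (F p) ∘ F)
      ((extChartAt 𝓘(ℝ, E') p).symm (extChartAt 𝓘(ℝ, E') p p'))
      (A.comp B : E' →L[ℝ] E) := by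
    rw [hp']; exact b
  have c := b'.comp _ a3.hasMFDerivAt
  set C : E' →L[ℝ] E' := mfderiv 𝓘(ℝ, E') 𝓘(ℝ, E') (extChartAt 𝓘(ℝ, E') p).symm
    (extChartAt 𝓘(ℝ, E') p p')
  have d : HasFDerivAt (extChartAt I (F p) ∘ F ∘ (extChartAt 𝓘(ℝ, E') p).symm)
    ((A.comp B).comp C) (extChartAt 𝓘(ℝ, E') p p') := hasMFDerivAt_iff_hasFDerivAt.1 c
  rw [d.fderiv]
  simp only [modelWithCornersSelf_coe, range_id, mfderivWithin_univ]
  rfl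

/-- Schwarz's theorem for the chart representative `Φ`, since `secondDeriv` is the derivative of
`fderiv ℝ Φ`. -/
theorem secondDeriv_symm {F : N → M} (hF : ContMDiff 𝓘(ℝ, E') I ∞ F) (p : N) (u w : E') :
    secondDeriv I 𝓘(ℝ, E') F p u w = secondDeriv I 𝓘(ℝ, E') F p w u := by
  set Φ := extChartAt I (F p) ∘ F ∘ (extChartAt 𝓘(ℝ, E') p).symm
  set y₀ := extChartAt 𝓘(ℝ, E') p p
  have hΦ : ContDiffAt ℝ ∞ Φ y₀ := by
    have := (contMDiffAt_iff.1 (hF p)).2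
    simpa [ContDiffAt] using! this
  have h1 := (hasChartDeriv_coordDeriv (hF p)).hasFDerivAt (by simp)
  have h2 : HasFDerivAt (fderiv ℝ Φ) (secondDeriv I 𝓘(ℝ, E') F p) y₀ := by
    refine h1.congr_of_eventuallyEq ?_
    have e := HasChartDeriv.eventually_comp_symm (I := 𝓘(ℝ, E')) (coordDeriv_eq_fderiv hF p)
    filter_upwards [e, (extChartAt_target_mem_nhds (I := 𝓘(ℝ, E')) p)] with y hy hy'
    rw [Function.comp_apply, hy, (extChartAt 𝓘(ℝ, E') p).right_inv hy']
  have h3 := hΦ.isSymmSndFDerivAt (by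
    rw [minSmoothness_of_isRCLikeNormedField]; exact WithTop.coe_le_coe.2 le_top)
  have h4 := h3 u w
  rwa [h2.fderiv] at h4

end Symmetry

/-! ## Components of tensor fields and of vector fields along maps -/

section Components

variable {E H : Type*} [NormedAddCommGroup E] [NormedSpace ℝ E] [TopologicalSpace H]
variable {I : ModelWithCorners ℝ E H} {M : Type*} [TopologicalSpace M] [ChartedSpace H M]
  [IsManifold I ∞ M]
variable {E' H' : Type*} [NormedAddCommGroup E'] [NormedSpace ℝ E'] [TopologicalSpace H']
variable {J : ModelWithCorners ℝ E' H'} {N : Type*} [TopologicalSpace N] [ChartedSpace H' N]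
  [IsManifold J ∞ N]

/-- The value of a 2-covariant tensor field, as a form on the model space. -/
def bilinAt (T : BilinField I M) (x : M) : E →L[ℝ] E →L[ℝ] ℝ := T x

/-- The value of a covector field, as a form on the model space. -/
def covAt (θ : CovField I M) (x : M) : E →L[ℝ] ℝ := θ x

/-- A tangent vector, as a vector of the model space. -/
def vecAt {x : M} (X : TangentSpace I x) : E := X

/-- Components, in the chart around `f p`, of a vector field along `f`. -/
def alongComponents (f : N → M) (ζ : ∀ p : N, TangentSpace I (f p)) (p p' : N) : E :=
  tangentCoordChange I (f p') (f p) (f p') (ζ p')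

omit [IsManifold J ∞ N] in
theorem alongComponents_self (f : N → M) (ζ : ∀ p : N, TangentSpace I (f p)) (p : N) :
    alongComponents f ζ p p = ζ p :=
  tangentCoordChange_self' _ _

theorem bilinComponents_self (T : BilinField I M) (x : M) :
    bilinComponents T x x = bilinAt T x := by
  refine ContinuousLinearMap.ext fun u => ContinuousLinearMap.ext fun w => ?_
  change bilinAt T x (tangentCoordChange I x x x u) (tangentCoordChange I x x x w) = _
  rw [tangentCoordChange_self', tangentCoordChange_self']

theorem covComponents_self (θ : CovField I M) (x : M) : covComponents θ x x = covAt θ x := by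
  refine ContinuousLinearMap.ext fun u => ?_
  change covAt θ x (tangentCoordChange I x x x u) = _
  rw [tangentCoordChange_self']

theorem tangentCoordChange_inv {x y : M} (hy : y ∈ (chartAt H x).source) (v : E) :
    tangentCoordChange I x y y (tangentCoordChange I y x y v) = v := by
  rw [tangentCoordChange_comp, tangentCoordChange_self']
  simp [hy]

theorem tangentCoordChange_inv' {x y : M} (hy : y ∈ (chartAt H x).source) (v : E) :
    tangentCoordChange I y x y (tangentCoordChange I x y y v) = v := by
  rw [tangentCoordChange_comp, tangentCoordChange_self]
  · simpa using hy
  · simp [hy]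

theorem eventually_mem_chart_source (x : M) : ∀ᶠ y in nhds x, y ∈ (chartAt H x).source :=
  (chartAt H x).open_source.mem_nhds (mem_chart_source H x)

theorem SmoothBilin.hasChartDeriv {T : BilinField I M} (hT : SmoothBilin I M T) (x : M) :
    HasChartDeriv I (bilinComponents T x) x (partialBilin T x) :=
  .of_mdifferentiableAt ((hT.components x).mdifferentiableAt (by simp))

theorem SmoothCov.hasChartDeriv {θ : CovField I M} (hθ : SmoothCov I M θ) (x : M) :
    HasChartDeriv I (covComponents θ x) x (partialCov θ x) :=
  .of_mdifferentiableAt ((hθ.components x).mdifferentiableAt (by simp))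

theorem hasChartDeriv_alongComponents {f : N → M} {ζ : ∀ p : N, TangentSpace I (f p)}
    (h : ContMDiff J I.tangent ∞ (fun p => (⟨f p, ζ p⟩ : TangentBundle I M))) (p : N) :
    HasChartDeriv J (alongComponents f ζ p) p (partialAlong (J := J) f ζ p) := by
  refine .of_mdifferentiableAt (ContMDiffAt.mdifferentiableAt (n := ∞) ?_ (by simp))
  exact (contMDiffAt_totalSpace.1 (h p)).2

/-! ### Pull-backs -/

/-- The coordinate change at `F p'` and its inverse cancel as long as `F p'` stays in the chart
domain around `F p`. -/
theorem bilinComponents_pullback (T : BilinField I M) {F : N → M} {p : N} (hF : ContinuousAt F p) :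
    ∀ᶠ p' in nhds p, bilinComponents (pullbackBilin (J := J) F T) p p'
      = (bilinComponents T (F p) (F p')).bilinearComp (coordDeriv I J F p p')
          (coordDeriv I J F p p') := by
  filter_upwards [hF (eventually_mem_chart_source (H := H) (F p))] with p' hp'
  refine ContinuousLinearMap.ext fun a => ContinuousLinearMap.ext fun b => ?_
  change bilinAt T (F p') (pushforward I J F p' (tangentCoordChange J p p' p' a))
      (pushforward I J F p' (tangentCoordChange J p p' p' b))
    = bilinAt T (F p') (tangentCoordChange I (F p) (F p') (F p')
        (tangentCoordChange I (F p') (F p) (F p')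
          (pushforward I J F p' (tangentCoordChange J p p' p' a))))
        (tangentCoordChange I (F p) (F p') (F p')
        (tangentCoordChange I (F p') (F p) (F p')
          (pushforward I J F p' (tangentCoordChange J p p' p' b))))
  rw [tangentCoordChange_inv hp', tangentCoordChange_inv hp']

theorem covComponents_pullback (θ : CovField I M) {F : N → M} {p : N} (hF : ContinuousAt F p) :
    ∀ᶠ p' in nhds p, covComponents (pullbackCov (J := J) F θ) p p'
      = (covComponents θ (F p) (F p')).comp (coordDeriv I J F p p') := by
  filter_upwards [hF (eventually_mem_chart_source (H := H) (F p))] with p' hp'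
  refine ContinuousLinearMap.ext fun a => ?_
  change covAt θ (F p') (pushforward I J F p' (tangentCoordChange J p p' p' a))
    = covAt θ (F p') (tangentCoordChange I (F p) (F p') (F p')
        (tangentCoordChange I (F p') (F p) (F p')
          (pushforward I J F p' (tangentCoordChange J p p' p' a))))
  rw [tangentCoordChange_inv hp']

theorem hasChartDeriv_pullbackBilin {T : BilinField I M} {F : N → M} {p : N}
    (hT : HasChartDeriv I (bilinComponents T (F p)) (F p) (partialBilin T (F p)))
    (hF : ContMDiffAt J I ∞ F p) :
    HasChartDeriv J (bilinComponents (pullbackBilin (J := J) F T) p) p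
      (partialBilin (pullbackBilin (J := J) F T) p) := by
  have hC := hasChartDeriv_coordDeriv hF
  have hTF := hT.comp_mdifferentiableAt (hF.mdifferentiableAt (by simp))
  -- `bilinearComp` is composition in the first slot, flip, composition in the second slot, flip
  -- back.
  have h5 := (((hTF.clm_comp hC).flip.clm_comp hC).flip).congr (bilinComponents_pullback (J := J) T hF.continuousAt)
  rw [partialBilin, h5.mvfderiv_eq]
  exact h5

/-- Product and chain rule. The second derivatives of `F` must be kept: they cancel in Lie
derivatives by symmetry and combine into the Gauss formula on the leaves. -/
theorem partialBilin_pullback {T : BilinField I M} {F : N → M} {p : N}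
    (hT : HasChartDeriv I (bilinComponents T (F p)) (F p) (partialBilin T (F p)))
    (hF : ContMDiffAt J I ∞ F p) (u a b : E') :
    partialBilin (pullbackBilin (J := J) F T) p u a b
      = partialBilin T (F p) (pushforward I J F p u) (pushforward I J F p a)
          (pushforward I J F p b)
        + bilinAt T (F p) (secondDeriv I J F p u a) (pushforward I J F p b)
        + bilinAt T (F p) (pushforward I J F p a) (secondDeriv I J F p u b) := by
  have hC := hasChartDeriv_coordDeriv hF
  have hTF := hT.comp_mdifferentiableAt (hF.mdifferentiableAt (by simp))
  have hCa := fun a : E' => hC.clm_apply (HasChartDeriv.const a p)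
  have h1 := (hTF.clm_apply (hCa a)).clm_apply (hCa b)
  have h2 := ((hasChartDeriv_pullbackBilin hT hF).clm_apply (.const a p)).clm_apply (.const b p)
  -- The same scalar function is differentiated through the components of the pull-back (`h2`) and
  -- through the product rule (`h1`).
  have h3 := h2.unique (h1.congr (by
    filter_upwards [bilinComponents_pullback (J := J) T hF.continuousAt] with p' hp'
    rw [hp']; rfl))
  have h4 := DFunLike.congr_fun h3 u
  simp only [add_apply, ContinuousLinearMap.comp_apply,
    ContinuousLinearMap.flip_apply, zero_apply, map_zero, zero_add,
    bilinComponents_self, coordDeriv_self] at h4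
  rw [h4]
  change _ + (bilinAt T (F p) (secondDeriv I J F p u a) (pushforward I J F p b)
    + partialBilin T (F p) (pushforward I J F p u) (pushforward I J F p a)
          (pushforward I J F p b)) = _
  ring

theorem partialCov_pullback {θ : CovField I M} {F : N → M} {p : N}
    (hθ : HasChartDeriv I (covComponents θ (F p)) (F p) (partialCov θ (F p)))
    (hF : ContMDiffAt J I ∞ F p) (u a : E') :
    partialCov (pullbackCov (J := J) F θ) p u a
      = partialCov θ (F p) (pushforward I J F p u) (pushforward I J F p a)
        + covAt θ (F p) (secondDeriv I J F p u a) := by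
  have hC := hasChartDeriv_coordDeriv hF
  have hTF := hθ.comp_mdifferentiableAt (hF.mdifferentiableAt (by simp))
  have h0 := hTF.clm_comp hC
  have h0' := h0.congr (covComponents_pullback (J := J) θ hF.continuousAt)
  have h5 : HasChartDeriv J (covComponents (pullbackCov (J := J) F θ) p) p
      (partialCov (pullbackCov (J := J) F θ) p) := by
    rw [partialCov, h0'.mvfderiv_eq]
    exact h0'
  have h1 := hTF.clm_apply (hC.clm_apply (HasChartDeriv.const a p))
  have h3 := (h5.clm_apply (.const a p)).unique (h1.congr (by
    filter_upwards [covComponents_pullback (J := J) θ hF.continuousAt] with p' hp'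
    rw [hp']; rfl))
  have h4 := DFunLike.congr_fun h3 u
  simp only [add_apply, ContinuousLinearMap.comp_apply,
    ContinuousLinearMap.flip_apply, zero_apply, map_zero, zero_add,
    covComponents_self, coordDeriv_self] at h4
  rw [h4, add_comm]
  rfl

/-! ### Vector fields along maps -/

theorem partialAlong_add {f : N → M} {ζ η : ∀ p : N, TangentSpace I (f p)} {p : N}
    (hζ : HasChartDeriv J (alongComponents f ζ p) p (partialAlong (J := J) f ζ p))
    (hη : HasChartDeriv J (alongComponents f η p) p (partialAlong (J := J) f η p)) :
    HasChartDeriv J (alongComponents f (fun p => ζ p + η p) p) p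
      (partialAlong (J := J) f ζ p + partialAlong (J := J) f η p) :=
  (hζ.add hη).congr (.of_forall fun _ => map_add _ _ _)

theorem partialAlong_smul {f : N → M} {ζ : ∀ p : N, TangentSpace I (f p)} {z : N → ℝ} {p : N}
    (hζ : HasChartDeriv J (alongComponents f ζ p) p (partialAlong (J := J) f ζ p))
    (hz : MDifferentiableAt J 𝓘(ℝ, ℝ) z p) :
    HasChartDeriv J (alongComponents f (fun p => z p • ζ p) p) p
      (z p • partialAlong (J := J) f ζ p
        + (covAt (differential (I := J) z) p).smulRight (alongComponents f ζ p p)) :=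
  ((HasChartDeriv.of_mdifferentiableAt hz).smul hζ).congr (.of_forall fun _ => map_smul _ _ _)

/-- In charts the components of `F_⋆ X` are `coordDeriv` applied to the components of `X`, so the
product rule applies. -/
theorem partialAlong_pushforward {F : N → M} {X : VField J N} {p : N} (hF : ContMDiffAt J I ∞ F p)
    (hX : HasChartDeriv J (alongComponents id X p) p (partialAlong (J := J) id X p)) :
    HasChartDeriv J (alongComponents F (fun p => mfderiv J I F p (X p)) p) p
      ((pushforward I J F p).comp (partialAlong (J := J) id X p)
        + (secondDeriv I J F p).flip (alongComponents id X p p)) := by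
  have h := ((hasChartDeriv_coordDeriv hF).clm_apply hX).congr
    (t := alongComponents F (fun p => mfderiv J I F p (X p)) p) (by
      filter_upwards [eventually_mem_chart_source (H := H') p] with p' hp'
      have e : ∀ v : E', tangentCoordChange I (F p') (F p) (F p') (pushforward I J F p' v)
        = tangentCoordChange I (F p') (F p) (F p') (pushforward I J F p'
            (tangentCoordChange J p p' p' (tangentCoordChange J p' p p' v))) := fun v => by
        rw [tangentCoordChange_inv hp']
      exact e (X p'))
  have e : coordDeriv I J F p p = pushforward I J F p :=
    ContinuousLinearMap.ext (coordDeriv_self F p)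
  rwa [e] at h

theorem pullLie_apply (T : BilinField I M) (f : N → M) (ζ : ∀ p : N, TangentSpace I (f p)) (p : N)
    (u w : E') : bilinAt (pullLie (J := J) T f ζ) p u w
      = partialBilin T (f p) (alongComponents f ζ p p) (pushforward I J f p u)
          (pushforward I J f p w)
        + bilinAt T (f p) (partialAlong (J := J) f ζ p u) (pushforward I J f p w)
        + bilinAt T (f p) (pushforward I J f p u) (partialAlong (J := J) f ζ p w) := by
  rw [alongComponents_self]
  rfl

omit [IsManifold J ∞ N] in
theorem pushforward_id (x : N) (u : E') : pushforward J J (id : N → N) x u = u := by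
  have : pushforward J J (id : N → N) x = ContinuousLinearMap.id ℝ E' := mfderiv_id
  rw [this]; rfl

theorem lieDeriv_apply (T : BilinField I M) (X : VField I M) (x : M) (u w : E) :
    bilinAt (lieDeriv T X) x u w = partialBilin T x (alongComponents id X x x) u w
      + bilinAt T x (partialAlong (J := I) (id : M → M) X x u) w
      + bilinAt T x u (partialAlong (J := I) (id : M → M) X x w) := by
  have h := pullLie_apply (J := I) T (id : M → M) X x u w
  rw [pushforward_id, pushforward_id] at h
  exact h

theorem pullLie_add (T : BilinField I M) {f : N → M} {ζ η : ∀ p : N, TangentSpace I (f p)} {p : N}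
    (hζ : HasChartDeriv J (alongComponents f ζ p) p (partialAlong (J := J) f ζ p))
    (hη : HasChartDeriv J (alongComponents f η p) p (partialAlong (J := J) f η p)) (u w : E') :
    bilinAt (pullLie (J := J) T f (fun p => ζ p + η p)) p u w
      = bilinAt (pullLie (J := J) T f ζ) p u w + bilinAt (pullLie (J := J) T f η) p u w := by
  have h : partialAlong (J := J) f (fun p => ζ p + η p) p = _ := (partialAlong_add hζ hη).mvfderiv_eq
  have e : alongComponents f (fun p => ζ p + η p) p p
    = alongComponents f ζ p p + alongComponents f η p p := map_add _ _ _
  simp only [pullLie_apply, h, e, map_add, add_apply]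
  ring

theorem pullLie_smul (T : BilinField I M) {f : N → M} {ζ : ∀ p : N, TangentSpace I (f p)}
    {z : N → ℝ} {p : N}
    (hζ : HasChartDeriv J (alongComponents f ζ p) p (partialAlong (J := J) f ζ p))
    (hz : MDifferentiableAt J 𝓘(ℝ, ℝ) z p) (u w : E') :
    bilinAt (pullLie (J := J) T f (fun p => z p • ζ p)) p u w
      = z p * bilinAt (pullLie (J := J) T f ζ) p u w
        + covAt (differential (I := J) z) p u * bilinAt T (f p) (alongComponents f ζ p p) (pushforward I J f p w)
        + covAt (differential (I := J) z) p w * bilinAt T (f p) (pushforward I J f p u) (alongComponents f ζ p p) := by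
  have h : partialAlong (J := J) f (fun p => z p • ζ p) p = _ :=
    (partialAlong_smul hζ hz).mvfderiv_eq
  have e : alongComponents f (fun p => z p • ζ p) p p
    = z p • alongComponents f ζ p p := map_smul _ _ _
  simp only [pullLie_apply, h, e, map_add, map_smul, add_apply,
    smul_apply, ContinuousLinearMap.smulRight_apply, smul_eq_mul]
  ring

/-- Only derivatives of `ζ` along the parameter space enter `pullLie`, so reparametrisation is the
chain rule. The first conjunct supplies the differentiability needed to add another field along `f ∘
φ`. -/
theorem pullLie_comp {E₂ H₂ : Type*} [NormedAddCommGroup E₂] [NormedSpace ℝ E₂]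
    [TopologicalSpace H₂] {K : ModelWithCorners ℝ E₂ H₂} {Q : Type*} [TopologicalSpace Q]
    [ChartedSpace H₂ Q] [IsManifold K ∞ Q] (T : BilinField I M) {f : N → M} {φ : Q → N}
    {ζ : ∀ p : N, TangentSpace I (f p)} {p : Q}
    (hζ : HasChartDeriv J (alongComponents f ζ (φ p)) (φ p) (partialAlong (J := J) f ζ (φ p)))
    (hf : MDifferentiableAt J I f (φ p)) (hφ : MDifferentiableAt K J φ p) (u w : E₂) :
    HasChartDeriv K (alongComponents (f ∘ φ) (fun q => ζ (φ q)) p) p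
      (partialAlong (J := K) (f ∘ φ) (fun q => ζ (φ q)) p) ∧
    bilinAt (pullLie (J := K) T (f ∘ φ) (fun q => ζ (φ q))) p u w
      = bilinAt (pullLie (J := J) T f ζ) (φ p) (pushforward J K φ p u) (pushforward J K φ p w) := by
  have h1 : HasChartDeriv K (alongComponents (f ∘ φ) (fun q => ζ (φ q)) p) p
    ((partialAlong (J := J) f ζ (φ p)).comp (pushforward J K φ p)) := hζ.comp_mdifferentiableAt hφ
  have h : partialAlong (J := K) (f ∘ φ) (fun q => ζ (φ q)) p = _ := h1.mvfderiv_eq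
  have e : pushforward I K (f ∘ φ) p = (pushforward I J f (φ p)).comp (pushforward J K φ p) :=
    mfderiv_comp p hf hφ
  refine ⟨h ▸ h1, ?_⟩
  rw [pullLie_apply T f, pullLie_apply, h, e]
  rfl

/-- Naturality of the Lie derivative for a tangential field. Differentiating the pulled-back tensor
produces second derivatives of `F` in the order `(X, u)`, differentiating `F_⋆ X` produces them in
the order `(u, X)`; they match by symmetry. -/
theorem pullLie_pushforward {T : BilinField I M} {F : N → M} {X : VField J N} {p : N}
    (hT : HasChartDeriv I (bilinComponents T (F p)) (F p) (partialBilin T (F p)))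
    (hF : ContMDiffAt J I ∞ F p)
    (hX : HasChartDeriv J (alongComponents id X p) p (partialAlong (J := J) id X p))
    (hsymm : ∀ u w, secondDeriv I J F p u w = secondDeriv I J F p w u) (u w : E') :
    bilinAt (pullLie (J := J) T F (fun p => mfderiv J I F p (X p))) p u w
      = bilinAt (lieDeriv (pullbackBilin (J := J) F T) X) p u w := by
  have h : partialAlong (J := J) F (fun p => mfderiv J I F p (X p)) p = _ :=
    (partialAlong_pushforward hF hX).mvfderiv_eq
  have e : alongComponents F (fun p => mfderiv J I F p (X p)) p p
      = pushforward I J F p (alongComponents id X p p) := by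
    rw [alongComponents_self, alongComponents_self]; rfl
  have e' : ∀ a b : E', bilinAt (pullbackBilin (J := J) F T) p a b
    = bilinAt T (F p) (pushforward I J F p a) (pushforward I J F p b) := fun _ _ => rfl
  rw [pullLie_apply, lieDeriv_apply, partialBilin_pullback hT hF, h, e, e', e']
  simp only [add_apply, ContinuousLinearMap.comp_apply,
    ContinuousLinearMap.flip_apply, map_add]
  rw [hsymm u, hsymm w]
  ring

/-! ### Contractions and differentials -/

/-- The covector field `T(X, ·)`. -/
def contract (T : BilinField I M) (X : VField I M) : CovField I M := fun x => T x (X x)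

/-- Product rule, used where the contraction is known: `γ(n, ·) = 0` eliminates derivatives of `n`,
and `γ(V, ·) = n(H) ℓ - dH` eliminates those of `V`. -/
theorem partialCov_contract {T : BilinField I M} {X : VField I M} {x : M}
    (hT : HasChartDeriv I (bilinComponents T x) x (partialBilin T x))
    (hX : HasChartDeriv I (alongComponents id X x) x (partialAlong (J := I) id X x)) (u w : E) :
    partialCov (contract T X) x u w = partialBilin T x u (alongComponents id X x x) w
      + bilinAt T x (partialAlong (J := I) (id : M → M) X x u) w := by
  have h := (hT.clm_apply hX).congr (t := covComponents (contract T X) x) (by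
    filter_upwards [eventually_mem_chart_source (H := H) x] with y hy
    refine ContinuousLinearMap.ext fun a => ?_
    have e : ∀ v : E, bilinAt T y v (tangentCoordChange I x y y a)
      = bilinAt T y (tangentCoordChange I x y y (tangentCoordChange I y x y v))
          (tangentCoordChange I x y y a) := fun v => by rw [tangentCoordChange_inv hy]
    exact e (X y))
  have h' : partialCov (contract T X) x = _ := h.mvfderiv_eq
  rw [h', bilinComponents_self]
  simp only [add_apply, ContinuousLinearMap.comp_apply,
    ContinuousLinearMap.flip_apply]
  exact add_comm _ _

theorem differential_comp {f : M → ℝ} {F : N → M} (hf : ∀ x, MDifferentiableAt I 𝓘(ℝ, ℝ) f x)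
    (hF : ∀ p, MDifferentiableAt J I F p) :
    differential (I := J) (f ∘ F) = pullbackCov (J := J) F (differential (I := I) f) := by
  funext p
  have h : mfderiv J 𝓘(ℝ, ℝ) (f ∘ F) p = _ := mfderiv_comp p (hf (F p)) (hF p)
  refine ContinuousLinearMap.ext fun u => ?_
  exact DFunLike.congr_fun h u

/-- Coordinate changes on `ℝ` are trivial. This lets `df` inherit regularity, and symmetry of its
partial derivatives, from the results on maps between manifolds. -/
theorem covComponents_differential (f : M → ℝ) (x y : M) :
    covComponents (differential (I := I) f) x y = coordDeriv 𝓘(ℝ, ℝ) I f x y := by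
  refine ContinuousLinearMap.ext fun u => ?_
  change covAt (differential (I := I) f) y (tangentCoordChange I x y y u)
    = tangentCoordChange 𝓘(ℝ, ℝ) (f y) (f x) (f y)
      (covAt (differential (I := I) f) y (tangentCoordChange I x y y u))
  have e : ∀ a b : ℝ, tangentCoordChange 𝓘(ℝ, ℝ) a b a = ContinuousLinearMap.id ℝ ℝ := fun a b =>
    tangentBundleCore_coordChange_model_space a b a
  rw [e]
  rfl

theorem hasChartDeriv_differential {f : M → ℝ} (hf : ContMDiff I 𝓘(ℝ, ℝ) ∞ f) (x : M) :
    HasChartDeriv I (covComponents (differential (I := I) f) x) x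
      (partialCov (differential (I := I) f) x) := by
  have h := (hasChartDeriv_coordDeriv (hf x)).congr
    (.of_forall fun y => covComponents_differential f x y)
  rw [partialCov, h.mvfderiv_eq]
  exact h

end Components

theorem partialCov_differential_symm {E : Type*} [NormedAddCommGroup E] [NormedSpace ℝ E]
    {N : Type*} [TopologicalSpace N] [ChartedSpace E N] [IsManifold 𝓘(ℝ, E) ∞ N]
    {f : N → ℝ} (hf : ContMDiff 𝓘(ℝ, E) 𝓘(ℝ, ℝ) ∞ f) (p : N) (u w : E) :
    partialCov (differential (I := 𝓘(ℝ, E)) f) p u w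
      = partialCov (differential (I := 𝓘(ℝ, E)) f) p w u := by
  have h := (hasChartDeriv_coordDeriv (hf p)).congr
    (.of_forall fun y => covComponents_differential f p y)
  have e : partialCov (differential (I := 𝓘(ℝ, E)) f) p = secondDeriv 𝓘(ℝ, ℝ) 𝓘(ℝ, E) f p :=
    h.mvfderiv_eq
  rw [e]
  exact secondDeriv_symm hf p u w

/-! ### Null metric data: the field `n`, the tensor `U`, the connection and its Hessian. -/

section

variable {E : Type*} [NormedAddCommGroup E] [NormedSpace ℝ E] [FiniteDimensional ℝ E]

variable (E) in
set_option synthInstance.maxHeartbeats 400000 in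
/-- `ambientForm`, as a continuous linear function of its three arguments. -/
def ambientFormCLM : ((E →L[ℝ] E →L[ℝ] ℝ) × (E →L[ℝ] ℝ) × ℝ) →L[ℝ]
    ((E × ℝ) →L[ℝ] (E × ℝ) →L[ℝ] ℝ) :=
  LinearMap.toContinuousLinearMap
    { toFun := fun x => ambientForm x.1 x.2.1 x.2.2
      map_add' := fun x y => ContinuousLinearMap.ext fun a => ContinuousLinearMap.ext fun b => by
        simp only [add_apply, ambientForm_apply, Prod.fst_add, Prod.snd_add]
        ring
      map_smul' := fun c x => ContinuousLinearMap.ext fun a => ContinuousLinearMap.ext fun b => by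
        simp only [smul_apply, ambientForm_apply, Prod.smul_fst, Prod.smul_snd, smul_eq_mul,
          RingHom.id_apply]
        ring }

theorem ambientFormCLM_apply (γ : E →L[ℝ] E →L[ℝ] ℝ) (l : E →L[ℝ] ℝ) (l2 : ℝ) :
    ambientFormCLM E (γ, l, l2) = ambientForm γ l l2 := rfl

/-- The two equations say that `𝒜` sends `(x, a)` to the second projection, and `𝒜` is invertible.
This recognises `n` after a change of chart and identifies it with the null generator. -/
theorem AmbientNondegenerate.nVec_eq {γ : E →L[ℝ] E →L[ℝ] ℝ} {l : E →L[ℝ] ℝ} {l2 : ℝ}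
    (h : AmbientNondegenerate γ l l2) {x : E} {a : ℝ} (h1 : ∀ w, γ x w + a * l w = 0)
    (h2 : l x + a * l2 = 1) : nVec γ l l2 = x := by
  have : (ambientForm γ l l2).inverse (ContinuousLinearMap.snd ℝ E ℝ) = (x, a) := by
    rw [h.isInvertible.inverse_apply_eq]
    refine ContinuousLinearMap.ext fun Z => ?_
    rw [ambientForm_apply]
    have := h1 Z.1
    change Z.2 = _
    dsimp only
    linear_combination -this - Z.2 * h2
  rw [nVec, this]

/-- Under these conditions `(x, 0)` lies in the radical of `𝒜`. Vector identities below are proved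
by testing a difference with `γ` and `ℓ`. -/
theorem AmbientNondegenerate.eq_zero {γ : E →L[ℝ] E →L[ℝ] ℝ} {l : E →L[ℝ] ℝ} {l2 : ℝ}
    (h : AmbientNondegenerate γ l l2) {x : E} (h1 : ∀ w, γ x w = 0) (h2 : l x = 0) : x = 0 := by
  have := h (x, 0) fun Z => by rw [ambientForm_apply]; simp [h1, h2]
  exact congrArg Prod.fst this

theorem AmbientNondegenerate.comp {γ : E →L[ℝ] E →L[ℝ] ℝ} {l : E →L[ℝ] ℝ} {l2 : ℝ}
    (h : AmbientNondegenerate γ l l2) {A B : E →L[ℝ] E} (hAB : ∀ v, A (B v) = v)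
    (hBA : ∀ v, B (A v) = v) :
    AmbientNondegenerate (γ.bilinearComp A A) (l.comp A) l2 := by
  intro X hX
  have := h (A X.1, X.2) fun Z => by
    have h1 := hX (B Z.1, Z.2)
    rw [ambientForm_apply] at h1 ⊢
    simpa [hAB] using h1
  have h1 : A X.1 = 0 := congrArg Prod.fst this
  have h2 : X.2 = 0 := congrArg Prod.snd this
  have h3 : X.1 = 0 := by rw [← hBA X.1, h1, map_zero]
  exact Prod.ext h3 h2

variable {N : Type*} [TopologicalSpace N] [ChartedSpace E N] [IsManifold 𝓘(ℝ, E) ∞ N]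

namespace MetricHypersurfaceData

variable (D : MetricHypersurfaceData 𝓘(ℝ, E) N)

theorem bilinComponents_nondegenerate {p y : N} (hy : y ∈ (chartAt E p).source) :
    AmbientNondegenerate (bilinComponents D.γ p y) (covComponents D.l p y) (D.l2 y) :=
  (D.nondegenerate y).comp (tangentCoordChange_inv hy) (tangentCoordChange_inv' hy)

/-- The defining equations of `n` are invariant under linear changes of coordinates, so its
components are the same algebraic function of the components of the data. -/
theorem alongComponents_n {p y : N} (hy : y ∈ (chartAt E p).source) :
    alongComponents id D.n p y
      = nVec (bilinComponents D.γ p y) (covComponents D.l p y) (D.l2 y) := by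
  symm
  have e : ∀ v : E, tangentCoordChange 𝓘(ℝ, E) p y y (tangentCoordChange 𝓘(ℝ, E) y p y v) = v :=
    tangentCoordChange_inv hy
  refine (D.bilinComponents_nondegenerate hy).nVec_eq (a := D.n2 y) (fun w => ?_) ?_
  · have := gamma_nVec (D.nondegenerate y) (tangentCoordChange 𝓘(ℝ, E) p y y w)
    refine Eq.trans ?_ this
    change bilinAt D.γ y (tangentCoordChange 𝓘(ℝ, E) p y y (tangentCoordChange 𝓘(ℝ, E) y p y
      (nVec (bilinAt D.γ y) (covAt D.l y) (D.l2 y)))) _ + _ = _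
    rw [e]
    rfl
  · have := l_nVec (D.nondegenerate y)
    refine Eq.trans ?_ this
    change covAt D.l y (tangentCoordChange 𝓘(ℝ, E) p y y (tangentCoordChange 𝓘(ℝ, E) y p y
      (nVec (bilinAt D.γ y) (covAt D.l y) (D.l2 y)))) + _ = _
    rw [e]
    rfl

set_option synthInstance.maxHeartbeats 400000 in
-- `n` depends on the data through `𝒜⁻¹`, and inversion is differentiable at an invertible operator.
theorem hasChartDeriv_n (p : N) : HasChartDeriv 𝓘(ℝ, E) (alongComponents id D.n p) p
    (partialAlong (J := 𝓘(ℝ, E)) id D.n p) := by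
  have hA := (D.bilinComponents_nondegenerate (mem_chart_source E p)).isInvertible
  rw [← ambientFormCLM_apply] at hA
  have h1 := HasFDerivWithinAt.prodMk (D.smooth_γ.hasChartDeriv p)
    (HasFDerivWithinAt.prodMk (D.smooth_l.hasChartDeriv p)
      (HasChartDeriv.of_mdifferentiableAt ((D.smooth_l2 p).mdifferentiableAt (by simp))))
  have h2 : HasChartDeriv 𝓘(ℝ, E)
      (fun y => (bilinComponents D.γ p y, covComponents D.l p y, D.l2 y)) p _ := h1
  have h4 := h2.comp_hasFDerivAt (ambientFormCLM E).hasFDerivAt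
  have h5 := h4.comp_hasFDerivAt
    ((hA.contDiffAt_map_inverse (n := 1)).differentiableAt (by simp)).hasFDerivAt
  have h6 := h5.clm_apply (HasChartDeriv.const (ContinuousLinearMap.snd ℝ E ℝ) p)
  have h7 := ((HasChartDeriv.const (ContinuousLinearMap.fst ℝ E ℝ) p).clm_apply h6).congr
    (t := alongComponents id D.n p) (by
      filter_upwards [eventually_mem_chart_source (H := E) p] with y hy
      rw [D.alongComponents_n hy]
      rfl)
  have h8 : partialAlong (J := 𝓘(ℝ, E)) id D.n p = _ := h7.mvfderiv_eq
  rw [h8]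
  exact h7

/-- The vector `n` at `p`, in the model space. -/
def nAt (p : N) : E := D.n p

variable {D}

theorem IsNull.γ_n (hD : D.IsNull) (p : N) (w : E) : bilinAt D.γ p (D.nAt p) w = 0 := by
  have h := gamma_nVec (D.nondegenerate p) w
  have h0 : nScal (E := E) (D.γ p) (D.l p) (D.l2 p) = 0 := hD p
  rw [h0, zero_mul, add_zero] at h
  exact h

theorem IsNull.l_n (hD : D.IsNull) (p : N) : covAt D.l p (D.nAt p) = 1 := by
  have h := l_nVec (D.nondegenerate p)
  have h0 : nScal (E := E) (D.γ p) (D.l p) (D.l2 p) = 0 := hD p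
  rw [h0, zero_mul, add_zero] at h
  exact h

theorem γ_symm (p : N) (u w : E) : bilinAt D.γ p u w = bilinAt D.γ p w u := D.symm_γ p u w

theorem partial_γ_symm (p : N) (v u w : E) :
    partialBilin D.γ p v u w = partialBilin D.γ p v w u :=
  partialBilin_symm D.smooth_γ D.symm_γ p v u w

/-- The derivative of the identity `γ(n, ·) = 0`. -/
theorem IsNull.partial_γ_n (hD : D.IsNull) (p : N) (u w : E) :
    partialBilin D.γ p u (D.nAt p) w
      + bilinAt D.γ p (partialAlong (J := 𝓘(ℝ, E)) (id : N → N) D.n p u) w = 0 := by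
  have h := partialCov_contract (D.smooth_γ.hasChartDeriv p) (D.hasChartDeriv_n p) u w
  rw [alongComponents_self] at h
  have e : ∀ y, covComponents (contract D.γ D.n) p y = 0 := fun y =>
    ContinuousLinearMap.ext fun a => hD.γ_n y _
  have h0 : partialCov (contract D.γ D.n) p = 0 :=
    ((HasChartDeriv.const (0 : E →L[ℝ] ℝ) p).congr (.of_forall e)).mvfderiv_eq
  rw [h0] at h
  exact h.symm

/-- The derivative of the identity `ℓ(n) = 1`. -/
theorem IsNull.partial_l_n (hD : D.IsNull) (p : N) (u : E) :
    partialCov D.l p u (D.nAt p)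
      + covAt D.l p (partialAlong (J := 𝓘(ℝ, E)) (id : N → N) D.n p u) = 0 := by
  have h1 := (D.smooth_l.hasChartDeriv p).clm_apply (D.hasChartDeriv_n p)
  have h2 := h1.unique ((HasChartDeriv.const (1 : ℝ) p).congr (by
    filter_upwards [eventually_mem_chart_source (H := E) p] with y hy
    have e : ∀ v : E, tangentCoordChange 𝓘(ℝ, E) p y y (tangentCoordChange 𝓘(ℝ, E) y p y v) = v :=
      tangentCoordChange_inv hy
    change covAt D.l y (tangentCoordChange 𝓘(ℝ, E) p y y (tangentCoordChange 𝓘(ℝ, E) y p y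
      (D.nAt y))) = _
    rw [e, hD.l_n]))
  have h3 := DFunLike.congr_fun h2 u
  rw [covComponents_self, alongComponents_self] at h3
  rw [add_comm]
  exact h3

theorem IsNull.U_eq (hD : D.IsNull) (p : N) (u w : E) :
    bilinAt D.U p u w = (1 / 2) * (partialBilin D.γ p (D.nAt p) u w
      + bilinAt D.γ p (partialAlong (J := 𝓘(ℝ, E)) (id : N → N) D.n p u) w
      + bilinAt D.γ p u (partialAlong (J := 𝓘(ℝ, E)) (id : N → N) D.n p w)) := by
  have h : D.n2 = fun _ => 0 := funext hD
  have h0 : ∀ a : E, covAt (differential (I := 𝓘(ℝ, E)) D.n2) p a = 0 := fun a => by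
    have : differential (I := 𝓘(ℝ, E)) D.n2 p = 0 := by
      rw [h]; exact mvfderiv_const _
    exact DFunLike.congr_fun this a
  have e := D.U_apply p u w
  refine Eq.trans e ?_
  change _ + 1 / 2 * (covAt D.l p u * covAt (differential (I := 𝓘(ℝ, E)) D.n2) p w
    + covAt (differential (I := 𝓘(ℝ, E)) D.n2) p u * covAt D.l p w) = _
  rw [h0, h0, mul_zero, zero_mul, add_zero, mul_zero, add_zero]
  rfl

variable (D) in
/-- `christoffelFirst D.γ`, written out. -/
theorem christoffelFirst_apply (p : N) (u w v : E) : christoffelFirst D.γ p u w v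
    = (1 / 2) * (partialBilin D.γ p u w v + partialBilin D.γ p w u v - partialBilin D.γ p v u w) :=
  rfl

/-- In `½ £_n γ` the derivatives of `n` are traded, through the derivative of `γ(n, ·) = 0`, for
derivatives of `γ` contracted with `n`. -/
theorem IsNull.U_eq_christoffel (hD : D.IsNull) (p : N) (u w : E) :
    bilinAt D.U p u w = - christoffelFirst D.γ p u w (D.nAt p) := by
  rw [hD.U_eq, christoffelFirst_apply, γ_symm p u, partial_γ_symm p u w, partial_γ_symm p w u]
  linear_combination (1 / 2) * hD.partial_γ_n p u w + (1 / 2) * hD.partial_γ_n p w u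

/-- Only `-½ (∂_u γ)(n, n)` survives in the Christoffel form of `U`, and it vanishes because `γ(n,
·) = 0` is differentiated and then contracted with `n` again. -/
theorem IsNull.U_n (hD : D.IsNull) (p : N) (u : E) : bilinAt D.U p u (D.nAt p) = 0 := by
  have h1 := hD.partial_γ_n p u (D.nAt p)
  rw [γ_symm, hD.γ_n] at h1
  rw [hD.U_eq_christoffel, christoffelFirst_apply, partial_γ_symm p _ u]
  linear_combination (-1 / 2) * h1

/-- Lowering the index uses `P γ = 1 - n ⊗ ℓ`; the correction along `ℓ` is what becomes `U` for null
data. -/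
theorem γ_connection (p : N) (u w v : E) : bilinAt D.γ p (D.connection p u w) v
    = christoffelFirst D.γ p u w v - christoffelFirst D.γ p u w (D.nAt p) * covAt D.l p v
      + (1 / 2) * (partialCov D.l p u w + partialCov D.l p w u) * bilinAt D.γ p (D.nAt p) v := by
  have h := gamma_pVec (E := E) (D.symm_γ p) (D.nondegenerate p) (christoffelFirst D.γ p u w) v
  have e : bilinAt D.γ p (D.connection p u w) v
    = bilinAt D.γ p (pVec (E := E) (D.γ p) (D.l p) (D.l2 p) (christoffelFirst D.γ p u w)) v
      + (1 / 2) * (partialCov D.l p u w + partialCov D.l p w u) * bilinAt D.γ p (D.nAt p) v := by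
    have e1 : D.connection p u w
      = pVec (E := E) (D.γ p) (D.l p) (D.l2 p) (christoffelFirst D.γ p u w)
        + ((1 / 2) * (partialCov D.l p u w + partialCov D.l p w u)) • D.nAt p := rfl
    rw [e1, map_add, map_smul]
    rfl
  rw [e]
  have h' : bilinAt D.γ p (pVec (E := E) (D.γ p) (D.l p) (D.l2 p) (christoffelFirst D.γ p u w)) v
    + christoffelFirst D.γ p u w (D.nAt p) * covAt D.l p v = christoffelFirst D.γ p u w v := h
  linear_combination h'

theorem IsNull.l_connection (hD : D.IsNull) {p : N} (hl2 : D.l2 p = 0) (u w : E) :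
    covAt D.l p (D.connection p u w)
      = (1 / 2) * (partialCov D.l p u w + partialCov D.l p w u) := by
  have h := l_pVec (E := E) (D.symm_γ p) (D.nondegenerate p) (christoffelFirst D.γ p u w)
  rw [hl2, zero_mul, add_zero] at h
  have h' : covAt D.l p (pVec (E := E) (D.γ p) (D.l p) (D.l2 p) (christoffelFirst D.γ p u w)) = 0 := by
    rw [hl2]; exact h
  have e1 : D.connection p u w
    = pVec (E := E) (D.γ p) (D.l p) (D.l2 p) (christoffelFirst D.γ p u w)
      + ((1 / 2) * (partialCov D.l p u w + partialCov D.l p w u)) • D.nAt p := rfl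
  rw [e1, map_add, map_smul, h', hD.l_n]
  simp

theorem eq_zero_of_γ_l {p : N} {x : E} (h1 : ∀ w, bilinAt D.γ p x w = 0)
    (h2 : covAt D.l p x = 0) : x = 0 :=
  (D.nondegenerate p).eq_zero h1 h2

/-- `∇°∇°f`, in terms of a vector `V` with `γ(V, ·) = n(f) ℓ - df`. -/
theorem IsNull.hessian_eq (hD : D.IsNull) {f : N → ℝ} {p : N} (hl2 : D.l2 p = 0) {V : E} {c : ℝ}
    (hV : ∀ w, bilinAt D.γ p V w = c * covAt D.l p w - covAt (differential (I := 𝓘(ℝ, E)) f) p w)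
    (u w : E) :
    D.hessian f p u w = partialCov (differential (I := 𝓘(ℝ, E)) f) p u w
      - c * ((1 / 2) * (partialCov D.l p u w + partialCov D.l p w u))
      + christoffelFirst D.γ p u w V + covAt D.l p V * bilinAt D.U p u w := by
  -- With `df = c ℓ - γ(V, ·)`, only the contractions of the connection coefficients with `ℓ` and
  -- `γ` are needed.
  have h1 := hV (D.connection p u w)
  have h2 := D.γ_connection p u w V
  have h3 : D.hessian f p u w = partialCov (differential (I := 𝓘(ℝ, E)) f) p u w
    - covAt (differential (I := 𝓘(ℝ, E)) f) p (D.connection p u w) := rfl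
  rw [hD.l_connection hl2, γ_symm, h2, hD.γ_n] at h1
  rw [h3, hD.U_eq_christoffel]
  linear_combination -h1

theorem hessian_symm {f : N → ℝ} (hf : ContMDiff 𝓘(ℝ, E) 𝓘(ℝ, ℝ) ∞ f)
    (p : N) (u w : E) : D.hessian f p u w = D.hessian f p w u := by
  have h1 : christoffelFirst D.γ p u w = christoffelFirst D.γ p w u := by
    refine ContinuousLinearMap.ext fun v => ?_
    rw [christoffelFirst_apply, christoffelFirst_apply, partial_γ_symm p v]
    ring
  have h2 : D.connection p u w = D.connection p w u := by
    unfold connection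
    rw [h1, add_comm (partialCov D.l p u w)]
  unfold hessian covariantDeriv
  rw [h2, partialCov_differential_symm hf]

theorem hasChartDeriv_differential_n {f : N → ℝ} (hf : ContMDiff 𝓘(ℝ, E) 𝓘(ℝ, ℝ) ∞ f) (p : N) :
    HasChartDeriv 𝓘(ℝ, E) (fun q => covAt (differential (I := 𝓘(ℝ, E)) f) q (D.nAt q)) p
      ((covComponents (differential (I := 𝓘(ℝ, E)) f) p p).comp
          (partialAlong (J := 𝓘(ℝ, E)) (id : N → N) D.n p)
        + (partialCov (differential (I := 𝓘(ℝ, E)) f) p).flip (alongComponents id D.n p p)) :=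
  ((hasChartDeriv_differential hf p).clm_apply (D.hasChartDeriv_n p)).congr
    (by
      filter_upwards [eventually_mem_chart_source (H := E) p] with y hy
      have e : ∀ v : E, tangentCoordChange 𝓘(ℝ, E) p y y
        (tangentCoordChange 𝓘(ℝ, E) y p y v) = v := tangentCoordChange_inv hy
      change _ = covAt (differential (I := 𝓘(ℝ, E)) f) y (tangentCoordChange 𝓘(ℝ, E) p y y
        (tangentCoordChange 𝓘(ℝ, E) y p y (D.nAt y)))
      rw [e])

/-- `(∇°∇°f)(·, n) = d(n(f)) + U(·, V)`. -/
theorem IsNull.hessian_n (hD : D.IsNull) {f : N → ℝ} (hf : ContMDiff 𝓘(ℝ, E) 𝓘(ℝ, ℝ) ∞ f) {p : N}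
    (hl2 : D.l2 p = 0) (hl : ∀ u w, partialCov D.l p u w = partialCov D.l p w u) {V : E} {c : ℝ}
    (hV : ∀ w, bilinAt D.γ p V w = c * covAt D.l p w - covAt (differential (I := 𝓘(ℝ, E)) f) p w)
    (u : E) :
    D.hessian f p u (D.nAt p)
      = covAt (differential (I := 𝓘(ℝ, E))
          (fun q => covAt (differential (I := 𝓘(ℝ, E)) f) q (D.nAt q))) p u
        + bilinAt D.U p u V := by
  have h1 := hasChartDeriv_differential_n (D := D) hf p
  have h2 := DFunLike.congr_fun h1.mvfderiv_eq u
  rw [covComponents_self, alongComponents_self] at h2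
  have h3 : covAt (differential (I := 𝓘(ℝ, E))
      (fun q => covAt (differential (I := 𝓘(ℝ, E)) f) q (D.nAt q))) p u
      = covAt (differential (I := 𝓘(ℝ, E)) f) p
          (partialAlong (J := 𝓘(ℝ, E)) (id : N → N) D.n p u)
        + partialCov (differential (I := 𝓘(ℝ, E)) f) p u (D.nAt p) := h2
  rw [h3, hD.hessian_eq hl2 hV, hD.U_n, christoffelFirst_apply, hD.U_eq,
    partial_γ_symm p _ u (D.nAt p)]
  -- The derivative of `n` inside `d(n(f))` is removed by `hV` and the derivatives of `ℓ(n) = 1` and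
  -- `γ(n, ·) = 0`. Closedness of `ℓ` reduces the symmetrised `∂ℓ` to a single term.
  have h4 := hV (partialAlong (J := 𝓘(ℝ, E)) (id : N → N) D.n p u)
  rw [γ_symm] at h4
  have h5 := hD.partial_l_n p u
  have h6 := hD.partial_γ_n p u V
  have h7 := hD.partial_γ_n p V u
  rw [γ_symm p _ u] at h7
  linear_combination - h4 - c * h5 - (1 / 2) * c * (hl (D.nAt p) u) + (1 / 2) * h6 - (1 / 2) * h7

end MetricHypersurfaceData

end

/-! ### Frames complementing the null direction, and the gauge vector. -/

section Frames

variable {E : Type*} [NormedAddCommGroup E] [NormedSpace ℝ E] [FiniteDimensional ℝ E]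
variable {N : Type*} [TopologicalSpace N] [ChartedSpace E N] [IsManifold 𝓘(ℝ, E) ∞ N]
variable {D : MetricHypersurfaceData 𝓘(ℝ, E) N} {p : N} {m : ℕ} {e : Fin m → E}

/-- `{n, e_A}` spans the tangent space at `p` and `ℓ(e_A) = 0`, with `{e_A}` independent. -/
structure IsTransverseFrame (D : MetricHypersurfaceData 𝓘(ℝ, E) N) (p : N) (e : Fin m → E) :
    Prop where
  indep : LinearIndependent ℝ e
  span : Submodule.span ℝ (range (Fin.cons (D.nAt p) e : Fin (m + 1) → E)) = ⊤
  l_eq : ∀ A, covAt D.l p (e A) = 0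

theorem IsAdaptedFrame.isTransverseFrame {lam : N → ℝ} {e : Fin m → TangentSpace 𝓘(ℝ, E) p}
    (h : IsAdaptedFrame D lam p e) (hl : D.l = differential (I := 𝓘(ℝ, E)) lam) :
    IsTransverseFrame D p e where
  indep := (linearIndependent_finCons.1 h.1).1
  span := h.2.1
  l_eq A := by rw [hl]; exact h.2.2 A

namespace IsTransverseFrame

open MetricHypersurfaceData

/-- Testing against the `e_A` suffices, since the product with the remaining frame vector `n`
vanishes automatically. -/
theorem eq_zero (he : IsTransverseFrame D p e) (hD : D.IsNull) {x : E}
    (h1 : ∀ A, bilinAt D.γ p x (e A) = 0) (h2 : covAt D.l p x = 0) : x = 0 := by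
  refine eq_zero_of_γ_l (fun w => ?_) h2
  have hw : w ∈ Submodule.span ℝ (range (Fin.cons (D.nAt p) e : Fin (m + 1) → E)) := by
    rw [he.span]; trivial
  have : Submodule.span ℝ (range (Fin.cons (D.nAt p) e : Fin (m + 1) → E))
      ≤ LinearMap.ker (bilinAt D.γ p x).toLinearMap := by
    rw [Submodule.span_le]
    rintro _ ⟨i, rfl⟩
    refine Fin.cases ?_ (fun A => ?_) i
    · change bilinAt D.γ p x (D.nAt p) = 0
      rw [γ_symm, hD.γ_n]
    · exact h1 A
  exact this hw

/-- The matrix `h_{AB}`. -/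
def gram (D : MetricHypersurfaceData 𝓘(ℝ, E) N) (p : N) (e : Fin m → E) :
    Matrix (Fin m) (Fin m) ℝ :=
  Matrix.of fun A B => bilinAt D.γ p (e A) (e B)

theorem gram_mulVec (c : Fin m → ℝ) (B : Fin m) :
    (gram D p e).mulVec c B = bilinAt D.γ p (∑ A, c A • e A) (e B) := by
  rw [γ_symm, map_sum]
  simp only [Matrix.mulVec, dotProduct, gram, Matrix.of_apply, map_smul, smul_eq_mul]
  exact Finset.sum_congr rfl fun A _ => mul_comm _ _

/-- A kernel vector of the matrix would give a combination of the `e_A` that is `γ`-orthogonal to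
all `e_B` and killed by `ℓ`, hence zero, against independence. -/
theorem det_gram (he : IsTransverseFrame D p e) (hD : D.IsNull) : IsUnit (gram D p e).det := by
  rw [isUnit_iff_ne_zero]
  intro h
  obtain ⟨c, hc, h0⟩ := Matrix.exists_mulVec_eq_zero_iff.2 h
  refine hc (funext fun A => ?_)
  refine Fintype.linearIndependent_iff.1 he.indep c (he.eq_zero hD (fun B => ?_) ?_) A
  · rw [← gram_mulVec, h0]; rfl
  · rw [map_sum]
    exact Finset.sum_eq_zero fun A _ => by rw [map_smul, he.l_eq, smul_zero]

/-- The vector of the gauge transformation, in terms of the differential `h` of the step function. -/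
theorem gaugeVector (he : IsTransverseFrame D p e) (hD : D.IsNull) {h : E →L[ℝ] ℝ} {V : E}
    (hn : h (D.nAt p) ≠ 0)
    (hV : ∀ w, bilinAt D.γ p V w = h (D.nAt p) * covAt D.l p w - h w)
    (hVV : h V = - (h (D.nAt p) * covAt D.l p V)) :
    covAt D.l p V
      = (∑ A, ∑ B, (gram D p e)⁻¹ A B * h (e A) * h (e B)) / (2 * h (D.nAt p)) ∧
    V = ∑ A, ∑ B, ((gram D p e)⁻¹ A B * h (e A)) •
      ((h (e B) / (2 * h (D.nAt p))) • D.nAt p - e B) ∧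
    ∀ θ : E →L[ℝ] ℝ, θ (D.nAt p) = 0 →
      θ V = - ∑ A, ∑ B, (gram D p e)⁻¹ A B * h (e A) * θ (e B) := by
  set c := h (D.nAt p) with hc
  -- `S` is the gradient of the step function along the leaf: it will satisfy `γ(S, e_C) = h(e_C)`
  -- and `ℓ(S) = 0`.
  set S : E := ∑ A, ∑ B, ((gram D p e)⁻¹ A B * h (e A)) • e B with hS
  set q := ∑ A, ∑ B, (gram D p e)⁻¹ A B * h (e A) * h (e B) with hq
  have map_S : ∀ θ : E →L[ℝ] ℝ, θ S = ∑ A, ∑ B, (gram D p e)⁻¹ A B * h (e A) * θ (e B) := by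
    intro θ
    simp only [hS, map_sum, map_smul, smul_eq_mul]
  have l_S : covAt D.l p S = 0 := by
    rw [map_S]
    simp only [he.l_eq, mul_zero, Finset.sum_const_zero]
  have γ_S : ∀ C, bilinAt D.γ p S (e C) = h (e C) := by
    intro C
    rw [γ_symm, map_S]
    have h1 : ((gram D p e)⁻¹ * gram D p e) = 1 := Matrix.nonsing_inv_mul _ (he.det_gram hD)
    have h2 : ∀ A, ∑ B, (gram D p e)⁻¹ A B * bilinAt D.γ p (e B) (e C)
        = (1 : Matrix (Fin m) (Fin m) ℝ) A C := fun A => by rw [← h1]; rfl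
    calc ∑ A, ∑ B, (gram D p e)⁻¹ A B * h (e A) * bilinAt D.γ p (e C) (e B)
        = ∑ A, h (e A) * ∑ B, (gram D p e)⁻¹ A B * bilinAt D.γ p (e B) (e C) := by
          refine Finset.sum_congr rfl fun A _ => ?_
          rw [Finset.mul_sum]
          refine Finset.sum_congr rfl fun B _ => ?_
          rw [γ_symm p (e C)]
          ring
      _ = h (e C) := by simp [h2, Matrix.one_apply]
  have hVS : V = covAt D.l p V • D.nAt p - S := by
    have : V - (covAt D.l p V • D.nAt p - S) = 0 := by
      refine he.eq_zero hD (fun C => ?_) ?_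
      · simp only [map_sub, map_smul, sub_apply, smul_apply, hV, hD.γ_n, γ_S, he.l_eq]
        simp
      · simp [hD.l_n, l_S]
    exact sub_eq_zero.1 this
  -- Applying `h` to `V = ℓ(V) n - S` gives `ℓ(V) c - q`, while `hVV` gives `-c ℓ(V)`; hence `2 c
  -- ℓ(V) = q`.
  have hl : covAt D.l p V = q / (2 * c) := by
    have h1 : h V = covAt D.l p V * c - q := by
      conv_lhs => rw [hVS]
      rw [map_sub, map_smul, map_S, smul_eq_mul]
    field_simp
    linear_combination hVV - h1
  refine ⟨hl, ?_, fun θ hθ => ?_⟩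
  · conv_lhs => rw [hVS]
    simp only [smul_sub, Finset.sum_sub_distrib, ← hS, hl, smul_smul, ← Finset.sum_smul]
    congr 2
    rw [hq, Finset.sum_div]
    refine Finset.sum_congr rfl fun A _ => ?_
    rw [Finset.sum_div]
    exact Finset.sum_congr rfl fun B _ => by rw [mul_div_assoc]
  · conv_lhs => rw [hVS]
    rw [map_sub, map_smul, hθ, smul_zero, zero_sub, map_S]

end IsTransverseFrame

end Frames

/-! ### Consequences of the foliated gauge, and the null direction under `φ`. -/

section Embedded

open MetricHypersurfaceData

variable {E₂ H₂ : Type*} [NormedAddCommGroup E₂] [NormedSpace ℝ E₂] [TopologicalSpace H₂]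
variable {I : ModelWithCorners ℝ E₂ H₂} {M : Type*} [TopologicalSpace M] [ChartedSpace H₂ M]
  [IsManifold I ∞ M]
variable {E : Type*} [NormedAddCommGroup E] [NormedSpace ℝ E] [FiniteDimensional ℝ E]
variable {N : Type*} [TopologicalSpace N] [ChartedSpace E N] [IsManifold 𝓘(ℝ, E) ∞ N]

/-- The preimage `X` of `k` satisfies the defining equations of `n`, so `n = X`. Then `ℓ` and `dv`
both equal `1` on `n`, and orthogonality of `L` to the leaves makes `ℓ` vanish on the kernel of
`dv`. -/
theorem IsFoliatedGauge.l_eq {D : HypersurfaceData 𝓘(ℝ, E) N} {g : LorentzMetric I M} {f : N → M}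
    {L k : ∀ p : N, TangentSpace I (f p)} {v : M → ℝ}
    (h : IsFoliatedGauge (J := 𝓘(ℝ, E)) g f L k v) (hD : IsEmbeddedData D g f L)
    (hnull : D.IsNull) : D.l = differential (I := 𝓘(ℝ, E)) (v ∘ f) ∧ ∀ p, D.l2 p = 0 := by
  have hl2 : ∀ p, D.l2 p = 0 := fun p => (hD.l2_eq p).trans (h.L_null p)
  refine ⟨funext fun p => ContinuousLinearMap.ext fun u => ?_, hl2⟩
  obtain ⟨X, hX⟩ := h.k_tangent p
  have hγ : ∀ w, bilinAt D.γ p X w = 0 := fun w => by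
    rw [hD.γ_eq]
    have := h.k_normal p w
    rw [← hX] at this
    exact this
  have hlX : covAt D.l p X = 1 := by
    have := hD.l_eq p X
    rw [hX, h.L_k] at this
    exact this
  have hXn : D.nAt p = X :=
    (D.nondegenerate p).nVec_eq (a := 0) (fun w => by rw [zero_mul, add_zero]; exact hγ w)
      (by rw [zero_mul, add_zero]; exact hlX)
  set dv : E →L[ℝ] ℝ := covAt (differential (I := 𝓘(ℝ, E)) (v ∘ f)) p
  have hv : dv (D.nAt p) = 1 := by rw [hXn]; exact h.k_v p X hX
  have key : ∀ w : E, covAt D.l p w = dv w := fun w => by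
    -- Subtracting `dv(w) n` from `w` gives a vector tangent to the leaf, where `L_orthogonal`
    -- applies.
    have h0 : dv (w - dv w • D.nAt p) = 0 := by simp [hv]
    have h1 : covAt D.l p (w - dv w • D.nAt p) = 0 :=
      (hD.l_eq p _).trans (h.L_orthogonal p _ h0)
    rw [map_sub, map_smul, hnull.l_n, smul_eq_mul, mul_one] at h1
    exact sub_eq_zero.1 h1
  exact key u

/-- A diffeomorphism that preserves the degenerate metrics preserves the null directions. -/
theorem pushforward_n {D D' : MetricHypersurfaceData 𝓘(ℝ, E) N} (hD : D.IsNull)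
    (hD' : D'.IsNull) {φ : N ≃ₘ⟮𝓘(ℝ, E), 𝓘(ℝ, E)⟯ N}
    (hγ : pullbackBilin φ D'.γ = D.γ) {h : E →L[ℝ] ℝ} {p : N}
    (hl : ∀ u, covAt D'.l (φ p) (pushforward 𝓘(ℝ, E) 𝓘(ℝ, E) φ p u) = h u) :
    pushforward 𝓘(ℝ, E) 𝓘(ℝ, E) φ p (D.nAt p) = h (D.nAt p) • D'.nAt (φ p) := by
  -- Tests against `φ_⋆ u` detect every vector only because the differential of `φ` is onto.
  have hsurj : ∀ w : E, ∃ u, pushforward 𝓘(ℝ, E) 𝓘(ℝ, E) φ p u = w := by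
    intro w
    obtain ⟨u, hu⟩ := (φ.mfderivToContinuousLinearEquiv (by simp) p).surjective w
    exact ⟨u, hu⟩
  have : pushforward 𝓘(ℝ, E) 𝓘(ℝ, E) φ p (D.nAt p) - h (D.nAt p) • D'.nAt (φ p) = 0 := by
    refine eq_zero_of_γ_l (D := D') (p := φ p) (fun w => ?_) ?_
    · obtain ⟨u, rfl⟩ := hsurj w
      have h1 : bilinAt D'.γ (φ p) (pushforward 𝓘(ℝ, E) 𝓘(ℝ, E) φ p (D.nAt p))
          (pushforward 𝓘(ℝ, E) 𝓘(ℝ, E) φ p u) = 0 := by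
        have h2 := hD.γ_n p u
        rw [← hγ] at h2
        exact h2
      simp [h1, hD'.γ_n]
    · simp [hl, hD'.l_n]
  exact sub_eq_zero.1 this

end Embedded

/-! ### The gauge equations and the change of `Y` under a change of rigging. -/

section Gauge

open MetricHypersurfaceData

variable {E₂ H₂ : Type*} [NormedAddCommGroup E₂] [NormedSpace ℝ E₂] [TopologicalSpace H₂]
variable {I : ModelWithCorners ℝ E₂ H₂} {M : Type*} [TopologicalSpace M] [ChartedSpace H₂ M]
  [IsManifold I ∞ M]
variable {E : Type*} [NormedAddCommGroup E] [NormedSpace ℝ E] [FiniteDimensional ℝ E]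
variable {N : Type*} [TopologicalSpace N] [ChartedSpace E N] [IsManifold 𝓘(ℝ, E) ∞ N]
variable {D D' : MetricHypersurfaceData 𝓘(ℝ, E) N} {φ : N ≃ₘ⟮𝓘(ℝ, E), 𝓘(ℝ, E)⟯ N}
  {z : N → ℝ} {V : VField 𝓘(ℝ, E) N} {v : N → ℝ}

theorem covAt_pullback_differential (hl' : D'.l = differential (I := 𝓘(ℝ, E)) v)
    (hv : ContMDiff 𝓘(ℝ, E) 𝓘(ℝ, ℝ) ∞ v) (p : N) (u : E) :
    covAt D'.l (φ p) (pushforward 𝓘(ℝ, E) 𝓘(ℝ, E) φ p u)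
      = covAt (differential (I := 𝓘(ℝ, E)) (v ∘ φ)) p u := by
  rw [differential_comp (I := 𝓘(ℝ, E)) (fun x => (hv x).mdifferentiableAt (by simp))
    (fun q => (φ.contMDiff q).mdifferentiableAt (by simp)), hl']
  rfl

/-- `n` lies in the radical of `γ`, so the covector equation evaluated on `n` fixes `z`; multiplied
by `n(H)` it then isolates `γ(V, ·)`. The scalar equation reduces to `2 dH(V) + γ(V, V) = 0`, and
the formula for `γ(V, ·)` is inserted. -/
theorem IsGaugeMatching.gauge_equations (h : IsGaugeMatching D D' φ z V) (hD : D.IsNull)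
    (hl2 : ∀ p, D.l2 p = 0) (hl2' : ∀ p, D'.l2 p = 0)
    (hl' : D'.l = differential (I := 𝓘(ℝ, E)) v) (hv : ContMDiff 𝓘(ℝ, E) 𝓘(ℝ, ℝ) ∞ v) (p : N)
    {dH : E →L[ℝ] ℝ} (hdH : dH = covAt (differential (I := 𝓘(ℝ, E)) (v ∘ φ)) p) :
    z p * dH (D.nAt p) = 1 ∧
    (∀ w : E, bilinAt D.γ p (vecAt (V p)) w = dH (D.nAt p) * covAt D.l p w - dH w) ∧
    dH (vecAt (V p)) = - (dH (D.nAt p) * covAt D.l p (vecAt (V p))) := by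
  have hz := h.z_ne_zero p
  have e : ∀ w : E, z p * (dH w + bilinAt D.γ p (vecAt (V p)) w) = covAt D.l p w := by
    intro w
    have := h.l_eq p w
    rw [h.γ_eq] at this
    rw [hdH, ← covAt_pullback_differential hl' hv]
    exact this
  have h1 : z p * dH (D.nAt p) = 1 := by
    have := e (D.nAt p)
    rw [γ_symm, hD.γ_n, add_zero, hD.l_n] at this
    exact this
  have h2 : ∀ w : E, bilinAt D.γ p (vecAt (V p)) w = dH (D.nAt p) * covAt D.l p w - dH w := by
    intro w
    linear_combination dH (D.nAt p) * e w - (dH w + bilinAt D.γ p (vecAt (V p)) w) * h1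
  refine ⟨h1, h2, ?_⟩
  have h3 := h.l2_eq p
  rw [hl2, hl2', h.γ_eq] at h3
  have h4 : z p ^ 2 * (0 + 2 * dH (vecAt (V p)) + bilinAt D.γ p (vecAt (V p)) (vecAt (V p))) = 0 := by
    rw [hdH, ← covAt_pullback_differential hl' hv p (vecAt (V p))]
    exact h3
  have h5 := (mul_eq_zero.1 h4).resolve_left (pow_ne_zero 2 hz)
  rw [h2 (vecAt (V p))] at h5
  linear_combination h5

/-- Transformation of `Y` under a change of rigging with `z n(H) = 1` and `γ(V, ·) = n(H) ℓ - dH`. -/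
theorem half_pullLie_matchingRigging (hD : D.IsNull) (hl2 : ∀ p, D.l2 p = 0)
    {lam : N → ℝ} (hlam : ContMDiff 𝓘(ℝ, E) 𝓘(ℝ, ℝ) ∞ lam)
    (hl : D.l = differential (I := 𝓘(ℝ, E)) lam)
    {Dhat : HypersurfaceData 𝓘(ℝ, E) N} (hl2' : ∀ p, Dhat.l2 p = 0)
    (hl' : Dhat.l = differential (I := 𝓘(ℝ, E)) v) (hv : ContMDiff 𝓘(ℝ, E) 𝓘(ℝ, ℝ) ∞ v)
    {g : LorentzMetric I M} {f : N → M} {L : ∀ p : N, TangentSpace I (f p)}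
    (hemb : IsEmbeddedData Dhat g f L)
    (h : IsGaugeMatching D Dhat.toMetricHypersurfaceData φ z V) (p : N) (u w : E) :
    (1 / 2) * bilinAt (pullLie (J := 𝓘(ℝ, E)) g.g (f ∘ φ) (matchingRigging f L φ z V)) p u w
      = z p * (bilinAt (pullbackBilin (J := 𝓘(ℝ, E)) φ Dhat.Y) p u w
        + covAt D.l p (vecAt (V p)) * bilinAt D.U p u w - D.hessian (v ∘ φ) p u w) := by
  have hf := hemb.embedding.contMDiff
  have hφ := φ.contMDiff
  have hF : ContMDiff 𝓘(ℝ, E) I ∞ (f ∘ φ) := hf.comp hφ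
  have hH : ContMDiff 𝓘(ℝ, E) 𝓘(ℝ, ℝ) ∞ (v ∘ φ) := hv.comp hφ
  have gauge := fun q => h.gauge_equations hD hl2 hl2' hl' hv q rfl
  set dH : N → E →L[ℝ] ℝ := fun q => covAt (differential (I := 𝓘(ℝ, E)) (v ∘ φ)) q with hdH
  have hfd : ∀ q, MDifferentiableAt 𝓘(ℝ, E) I f q := fun q => (hf q).mdifferentiableAt (by simp)
  have hφd : ∀ q, MDifferentiableAt 𝓘(ℝ, E) 𝓘(ℝ, E) φ q := fun q =>
    (hφ q).mdifferentiableAt (by simp)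
  have push : ∀ q a, pushforward I 𝓘(ℝ, E) (f ∘ φ) q a
      = pushforward I 𝓘(ℝ, E) f (φ q) (pushforward 𝓘(ℝ, E) 𝓘(ℝ, E) φ q a) := fun q a => by
    have : pushforward I 𝓘(ℝ, E) (f ∘ φ) q = (pushforward I 𝓘(ℝ, E) f (φ q)).comp
      (pushforward 𝓘(ℝ, E) 𝓘(ℝ, E) φ q) := mfderiv_comp q (hfd _) (hφd q)
    rw [this]; rfl
  have hγF : pullbackBilin (J := 𝓘(ℝ, E)) (f ∘ φ) g.g = D.γ := by
    rw [← h.γ_eq, hemb.γ_eq]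
    funext q
    refine ContinuousLinearMap.ext fun (a : E) => ContinuousLinearMap.ext fun (b : E) => ?_
    change bilinAt g.g (f (φ q)) (pushforward I 𝓘(ℝ, E) (f ∘ φ) q a)
      (pushforward I 𝓘(ℝ, E) (f ∘ φ) q b) = _
    rw [push, push]
    rfl
  -- the rigging, split
  set X : ∀ q : N, TangentSpace I ((f ∘ φ) q) := fun q => mfderiv 𝓘(ℝ, E) I (f ∘ φ) q (V q)
  set LF : ∀ q : N, TangentSpace I ((f ∘ φ) q) := fun q => L (φ q)
  have hrig : matchingRigging f L φ z V = fun q => z q • (LF q + X q) := by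
    funext q
    exact congrArg (fun a : E₂ => z q • (vecAt (L (φ q)) + a)) (push q (vecAt (V q))).symm
  have hVd := hasChartDeriv_alongComponents (f := (id : N → N)) (ζ := V) h.smooth_V p
  obtain ⟨hLd, hLie⟩ := pullLie_comp (K := 𝓘(ℝ, E)) g.g (p := p)
    (hasChartDeriv_alongComponents hemb.rigging.smooth (φ p)) (hfd (φ p)) (hφd p) u w
  have hXd : HasChartDeriv 𝓘(ℝ, E) (alongComponents (f ∘ φ) X p) p
      (partialAlong (J := 𝓘(ℝ, E)) (f ∘ φ) X p) := by
    have := partialAlong_pushforward (hF p) hVd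
    rw [show partialAlong (J := 𝓘(ℝ, E)) (f ∘ φ) X p = _ from this.mvfderiv_eq]
    exact this
  have hsum := partialAlong_add hLd hXd
  have hsum' : HasChartDeriv 𝓘(ℝ, E) (alongComponents (f ∘ φ) (fun q => LF q + X q) p) p
      (partialAlong (J := 𝓘(ℝ, E)) (f ∘ φ) (fun q => LF q + X q) p) := by
    rw [show partialAlong (J := 𝓘(ℝ, E)) (f ∘ φ) (fun q => LF q + X q) p = _ from
      hsum.mvfderiv_eq]
    exact hsum
  have hzd : MDifferentiableAt 𝓘(ℝ, E) 𝓘(ℝ, ℝ) z p := (h.smooth_z p).mdifferentiableAt (by simp)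
  -- Leibniz rule for `z`, additivity, reparametrisation for `L`, naturality for the tangential
  -- part: what is left to compute is `£_V γ`.
  rw [hrig, pullLie_smul g.g hsum' hzd, pullLie_add g.g hLd hXd, hLie,
    pullLie_pushforward (g.smooth.hasChartDeriv _) (hF p) hVd (secondDeriv_symm hF p), hγF]
  -- inner products of the rigging with tangent vectors
  have hgη : ∀ a : E, bilinAt g.g ((f ∘ φ) p) (alongComponents (f ∘ φ) (fun q => LF q + X q) p p)
      (pushforward I 𝓘(ℝ, E) (f ∘ φ) p a) = dH p (D.nAt p) * covAt D.l p a := by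
    intro a
    have e1 : bilinAt g.g ((f ∘ φ) p) (vecAt (LF p)) (pushforward I 𝓘(ℝ, E) (f ∘ φ) p a) = dH p a := by
      rw [push, hdH, ← covAt_pullback_differential hl' hv]
      exact (hemb.l_eq (φ p) _).symm
    have e2 : bilinAt g.g ((f ∘ φ) p) (vecAt (X p)) (pushforward I 𝓘(ℝ, E) (f ∘ φ) p a)
        = bilinAt D.γ p (vecAt (V p)) a := by rw [← hγF]; rfl
    have e3 : (alongComponents (f ∘ φ) (fun q => LF q + X q) p p : E₂)
      = vecAt (LF p) + vecAt (X p) := alongComponents_self _ _ _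
    rw [e3, map_add, add_apply, e1, e2, (gauge p).2.1]
    ring
  have hgη' : ∀ a : E, bilinAt g.g ((f ∘ φ) p) (pushforward I 𝓘(ℝ, E) (f ∘ φ) p a)
      (alongComponents (f ∘ φ) (fun q => LF q + X q) p p) = dH p (D.nAt p) * covAt D.l p a :=
    fun a => (g.symm _ _ _).trans (hgη a)
  rw [hgη, hgη']
  have hY : bilinAt (pullLie (J := 𝓘(ℝ, E)) g.g f L) (φ p)
      (pushforward 𝓘(ℝ, E) 𝓘(ℝ, E) φ p u) (pushforward 𝓘(ℝ, E) 𝓘(ℝ, E) φ p w)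
      = 2 * bilinAt (pullbackBilin (J := 𝓘(ℝ, E)) φ Dhat.Y) p u w := by
    have e0 : bilinAt Dhat.Y (φ p) = (1 / 2 : ℝ) • bilinAt (pullLie (J := 𝓘(ℝ, E)) g.g f L) (φ p) :=
      hemb.Y_eq (φ p)
    change _ = 2 * bilinAt Dhat.Y (φ p) (pushforward 𝓘(ℝ, E) 𝓘(ℝ, E) φ p u)
      (pushforward 𝓘(ℝ, E) 𝓘(ℝ, E) φ p w)
    rw [e0]
    simp only [smul_apply, smul_eq_mul]
    ring
  rw [hY]
  -- the Lie derivative of `γ` along `V`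
  have hc := hasChartDeriv_differential_n (D := D) hH p
  set c : N → ℝ := fun q => covAt (differential (I := 𝓘(ℝ, E)) (v ∘ φ)) q (D.nAt q) with hcdef
  have hc' : HasChartDeriv 𝓘(ℝ, E) c p (covAt (differential (I := 𝓘(ℝ, E)) c) p) := by
    have : covAt (differential (I := 𝓘(ℝ, E)) c) p = _ := hc.mvfderiv_eq
    rw [this]; exact hc
  -- The gauge equation holds at every point, so it may be differentiated; it replaces the
  -- derivatives of `V` by those of `c ℓ - dH`.
  have hθ : ∀ q, covComponents (contract D.γ V) p q
      = c q • covComponents D.l p q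
        - covComponents (differential (I := 𝓘(ℝ, E)) (v ∘ φ)) p q := fun q =>
    ContinuousLinearMap.ext fun a => (gauge q).2.1 _
  have hθd := ((hc'.smul (D.smooth_l.hasChartDeriv p)).sub (hasChartDeriv_differential hH p)).congr
    (.of_forall hθ)
  have hθd' : partialCov (contract D.γ V) p = _ := hθd.mvfderiv_eq
  have hcon : ∀ a b : E, partialBilin D.γ p a (vecAt (V p)) b
      + bilinAt D.γ p (partialAlong (J := 𝓘(ℝ, E)) (id : N → N) V p a) b
      = c p * partialCov D.l p a b + covAt (differential (I := 𝓘(ℝ, E)) c) p a * covAt D.l p b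
        - partialCov (differential (I := 𝓘(ℝ, E)) (v ∘ φ)) p a b := by
    intro a b
    have e1 := partialCov_contract (D.smooth_γ.hasChartDeriv p) hVd a b
    rw [hθd', covComponents_self] at e1
    refine Eq.trans ?_ e1.symm
    rw [alongComponents_self]
    rfl
  have hLieγ := lieDeriv_apply D.γ V p u w
  have hVp : alongComponents id V p p = vecAt (V p) := alongComponents_self _ _ _
  rw [hVp] at hLieγ
  -- `z n(H) = 1`, differentiated
  have hzc : ∀ a : E, z p * covAt (differential (I := 𝓘(ℝ, E)) c) p a
      + covAt (differential (I := 𝓘(ℝ, E)) z) p a * c p = 0 := fun a => by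
    have e1 := ((HasChartDeriv.of_mdifferentiableAt hzd).smul hc').unique
      ((HasChartDeriv.const (1 : ℝ) p).congr (.of_forall fun q => (gauge q).1))
    exact DFunLike.congr_fun e1 a
  have hKs := partialCov_differential_symm hH p u w
  have hls : partialCov D.l p u w = partialCov D.l p w u := by
    rw [hl]; exact partialCov_differential_symm hlam p u w
  rw [hD.hessian_eq (hl2 p) (gauge p).2.1, christoffelFirst_apply, hLieγ]
  have c1 := hcon u w
  have c2 := hcon w u
  rw [partial_γ_symm p u] at c1
  rw [partial_γ_symm p w, γ_symm p _ u] at c2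
  change _ = z p * (_ + _ - (_ - c p * _ + _ + _))
  change 1 / 2 * (_ + _ * (c p * _) + _ * (c p * _)) = _
  -- `c1` and `c2` symmetrise the derivative of `γ(V, ·)`. The resulting `z dc ⊗_s ℓ` cancels the
  -- Leibniz term `dz ⊗_s c ℓ` by `hzc`, and `hKs` identifies the symmetrised second partials of
  -- `H`.
  linear_combination (1 / 2) * z p * c1 + (1 / 2) * z p * c2
    + (1 / 2) * covAt D.l p w * hzc u + (1 / 2) * covAt D.l p u * hzc w + (1 / 2) * z p * hKs

end Gauge

/-! ### The Gauss formula on the leaves. -/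

section Leaf

open MetricHypersurfaceData

/-- In finite dimension trivial kernel gives invertibility, so `inverse` is the true inverse and not
its default value `0`. It is needed to make sense of `leviCivita`. -/
theorem bilin_apply_inverse {E : Type*} [NormedAddCommGroup E] [NormedSpace ℝ E]
    [FiniteDimensional ℝ E] (B : E →L[ℝ] E →L[ℝ] ℝ) (hB : ∀ x, (∀ w, B x w = 0) → x = 0)
    (f : E →L[ℝ] ℝ) : B (B.inverse f) = f := by
  have hinj : Function.Injective (B : E →ₗ[ℝ] (E →L[ℝ] ℝ)) := by
    rw [← LinearMap.ker_eq_bot, LinearMap.ker_eq_bot']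
    exact fun x hx => hB x fun w => DFunLike.congr_fun (hx : B x = 0) w
  have hdim : Module.finrank ℝ E = Module.finrank ℝ (E →L[ℝ] ℝ) := by
    rw [← (LinearMap.toContinuousLinearMap (𝕜 := ℝ) (E := E) (F' := ℝ)).finrank_eq]
    exact (Subspace.dual_finrank_eq (K := ℝ) (V := E)).symm
  have hinv : B.IsInvertible :=
    ⟨(LinearEquiv.ofInjectiveOfFinrankEq _ hinj hdim).toContinuousLinearEquiv,
      ContinuousLinearMap.ext fun _ => rfl⟩
  exact (hinv.inverse_apply_eq.1 rfl).symm

variable {E : Type*} [NormedAddCommGroup E] [NormedSpace ℝ E] [FiniteDimensional ℝ E]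
variable {N : Type*} [TopologicalSpace N] [ChartedSpace E N] [IsManifold 𝓘(ℝ, E) ∞ N]
variable {E₁ : Type*} [NormedAddCommGroup E₁] [NormedSpace ℝ E₁] [FiniteDimensional ℝ E₁]
variable {S : Type*} [TopologicalSpace S] [ChartedSpace E₁ S] [IsManifold 𝓘(ℝ, E₁) ∞ S]
variable {D : MetricHypersurfaceData 𝓘(ℝ, E) N} {m : ℕ}

/-- On vectors tangent to a leaf of `lam`, `∇°∇°f` is the Hessian of `f` for the induced metric. -/
theorem hessian_leaf (hD : D.IsNull) (hl2 : ∀ p, D.l2 p = 0) {lam : N → ℝ}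
    (hlam : ContMDiff 𝓘(ℝ, E) 𝓘(ℝ, ℝ) ∞ lam) (hl : D.l = differential (I := 𝓘(ℝ, E)) lam)
    {ψ : S → N} (hψ : ContMDiff 𝓘(ℝ, E₁) 𝓘(ℝ, E) ∞ ψ) {c : ℝ} (hc : ∀ s, lam (ψ s) = c)
    {s : S} {w : Fin m → E₁} (hw : Submodule.span ℝ (range w) = ⊤)
    (he : IsTransverseFrame D (ψ s) fun A => pushforward 𝓘(ℝ, E) 𝓘(ℝ, E₁) ψ s (w A))
    {f : N → ℝ} (hf : ContMDiff 𝓘(ℝ, E) 𝓘(ℝ, ℝ) ∞ f) (a b : E₁) :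
    NullMatching.hessian (pullbackBilin (J := 𝓘(ℝ, E₁)) ψ D.γ) (f ∘ ψ) s a b
      = D.hessian f (ψ s) (pushforward 𝓘(ℝ, E) 𝓘(ℝ, E₁) ψ s a)
          (pushforward 𝓘(ℝ, E) 𝓘(ℝ, E₁) ψ s b) := by
  have dcomp : ∀ {k : N → ℝ}, ContMDiff 𝓘(ℝ, E) 𝓘(ℝ, ℝ) ∞ k →
      differential (I := 𝓘(ℝ, E₁)) (k ∘ ψ) = pullbackCov ψ (differential (I := 𝓘(ℝ, E)) k) :=
    fun hk => differential_comp (fun x => (hk x).mdifferentiableAt (by simp))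
      (fun x => (hψ x).mdifferentiableAt (by simp))
  set P := pushforward 𝓘(ℝ, E) 𝓘(ℝ, E₁) ψ s with hP
  set h := pullbackBilin (J := 𝓘(ℝ, E₁)) ψ D.γ with hh
  have h_apply : ∀ x y : E₁, bilinAt h s x y = bilinAt D.γ (ψ s) (P x) (P y) := fun _ _ => rfl
  have dlam0 : differential (I := 𝓘(ℝ, E₁)) (lam ∘ ψ) = fun _ => 0 := by
    have : lam ∘ ψ = fun _ => c := funext hc
    rw [this]
    funext q
    exact mvfderiv_const _
  have l_P : ∀ x, covAt D.l (ψ s) (P x) = 0 := fun x => by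
    rw [hl]
    have := dcomp hlam
    rw [dlam0] at this
    exact (DFunLike.congr_fun (congrFun this s) x).symm
  have nondeg : ∀ x, (∀ y, bilinAt h s x y = 0) → x = 0 := by
    intro x hx
    have h1 : P x = 0 := he.eq_zero hD (fun A => hx (w A)) (l_P x)
    have h2 : x ∈ Submodule.span ℝ (range w) := by rw [hw]; trivial
    obtain ⟨k, rfl⟩ := (Submodule.mem_span_range_iff_exists_fun ℝ).1 h2
    rw [map_sum] at h1
    simp only [map_smul] at h1
    have h3 := Fintype.linearIndependent_iff.1 he.indep k h1
    simp [h3]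
  set G : E₁ := leviCivita h s a b with hG
  have hG' : ∀ y, bilinAt h s G y = christoffelFirst h s a b y := fun y =>
    DFunLike.congr_fun (bilin_apply_inverse (bilinAt h s) nondeg (christoffelFirst h s a b)) y
  set Q := secondDeriv 𝓘(ℝ, E) 𝓘(ℝ, E₁) ψ s with hQ
  have Q_symm : ∀ x y, Q x y = Q y x := secondDeriv_symm hψ s
  have partial_h : ∀ x y t : E₁, partialBilin h s x y t
      = partialBilin D.γ (ψ s) (P x) (P y) (P t) + bilinAt D.γ (ψ s) (Q x y) (P t)
        + bilinAt D.γ (ψ s) (P y) (Q x t) :=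
    partialBilin_pullback (D.smooth_γ.hasChartDeriv _) (hψ s)
  have partial_d : ∀ {k : N → ℝ}, ContMDiff 𝓘(ℝ, E) 𝓘(ℝ, ℝ) ∞ k →
      partialCov (differential (I := 𝓘(ℝ, E₁)) (k ∘ ψ)) s a b
        = partialCov (differential (I := 𝓘(ℝ, E)) k) (ψ s) (P a) (P b)
          + covAt (differential (I := 𝓘(ℝ, E)) k) (ψ s) (Q a b) := fun hk => by
    rw [dcomp hk]
    exact partialCov_pullback (hasChartDeriv_differential hk _) (hψ s) a b
  -- Gauss formula without second fundamental form: the Levi-Civita derivative on the leaf is pushed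
  -- forward to `∇°`. The difference is tested with `γ` on the frame, by comparing Christoffel
  -- symbols of the first kind, and with `ℓ`.
  have key : Q a b - P G + D.connection (ψ s) (P a) (P b) = 0 := by
    refine he.eq_zero hD (fun A => ?_) ?_
    · have e1 := hG' (w A)
      have e2 : christoffelFirst h s a b (w A) = (1 / 2) * (partialBilin h s a b (w A)
        + partialBilin h s b a (w A) - partialBilin h s (w A) a b) := rfl
      rw [e2, partial_h, partial_h, partial_h, h_apply, Q_symm (w A) a, Q_symm (w A) b,
        Q_symm b a, γ_symm _ (P b) (Q a (w A)), γ_symm _ (P a) (Q b (w A))] at e1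
      rw [map_add, map_sub, add_apply, sub_apply, γ_connection, l_P, hD.γ_n,
        christoffelFirst_apply]
      linear_combination -e1
    -- As `λ ∘ ψ` is constant, its second partials vanish, so `ℓ(Q a b)` is minus the derivative of
    -- `ℓ = dλ`; this offsets the `ℓ`-part of the connection.
    · have e1 := partial_d hlam
      have e2 : partialCov (differential (I := 𝓘(ℝ, E₁)) (lam ∘ ψ)) s = 0 := by
        have : ∀ y, covComponents (differential (I := 𝓘(ℝ, E₁)) (lam ∘ ψ)) s y = 0 := fun y => by
          rw [dlam0]; rfl
        exact ((HasChartDeriv.const (0 : E₁ →L[ℝ] ℝ) s).congr (.of_forall this)).mvfderiv_eq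
      rw [e2, ← hl] at e1
      have e3 : partialCov D.l (ψ s) (P a) (P b) = partialCov D.l (ψ s) (P b) (P a) := by
        rw [hl]; exact partialCov_differential_symm hlam _ _ _
      have e4 : (0 : ℝ) = partialCov D.l (ψ s) (P a) (P b) + covAt D.l (ψ s) (Q a b) := e1
      rw [map_add, map_sub, l_P, hD.l_connection (hl2 _)]
      linear_combination -e4 - (1 / 2) * e3
  have e1 : NullMatching.hessian h (f ∘ ψ) s a b
      = partialCov (differential (I := 𝓘(ℝ, E₁)) (f ∘ ψ)) s a b
        - covAt (differential (I := 𝓘(ℝ, E₁)) (f ∘ ψ)) s G := rfl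
  have e2 : D.hessian f (ψ s) (P a) (P b)
      = partialCov (differential (I := 𝓘(ℝ, E)) f) (ψ s) (P a) (P b)
        - covAt (differential (I := 𝓘(ℝ, E)) f) (ψ s) (D.connection (ψ s) (P a) (P b)) := rfl
  have e3 : covAt (differential (I := 𝓘(ℝ, E₁)) (f ∘ ψ)) s G
      = covAt (differential (I := 𝓘(ℝ, E)) f) (ψ s) (P G) := by
    rw [dcomp hf]; rfl
  have e4 := congrArg (covAt (differential (I := 𝓘(ℝ, E)) f) (ψ s)) key
  rw [map_add, map_sub, map_zero] at e4
  rw [e1, e2, e3, partial_d hf]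
  linear_combination e4

end Leaf

end NullMatching

end

/-! ### The matching theorem, assembled. -/

set_option maxHeartbeats 1000000 in
-- The formulas are tensorial, so frames are chosen at a single point. The leaf Hessian is intrinsic
-- to the leaf, which therefore enters as a manifold `S` embedded onto a level set of `λ`.
theorem theorem6p2 {m : ℕ}
    {N : Type*} [TopologicalSpace N] [ChartedSpace (EuclideanSpace ℝ (Fin (m + 1))) N]
    [IsManifold (𝓡 (m + 1)) ∞ N]
    {Mminus : Type*} [TopologicalSpace Mminus] [ChartedSpace (EuclideanHalfSpace (m + 2)) Mminus]
    [IsManifold (𝓡∂ (m + 2)) ∞ Mminus]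
    {Mplus : Type*} [TopologicalSpace Mplus] [ChartedSpace (EuclideanHalfSpace (m + 2)) Mplus]
    [IsManifold (𝓡∂ (m + 2)) ∞ Mplus]
    (gminus : LorentzMetric (𝓡∂ (m + 2)) Mminus) (gplus : LorentzMetric (𝓡∂ (m + 2)) Mplus)
    (D Dhat : HypersurfaceData (𝓡 (m + 1)) N)
    (hD : D.IsNull) (hDhat : Dhat.IsNull)
    (iminus : N → Mminus) (iplus : N → Mplus)
    (himinus : Set.range iminus = (𝓡∂ (m + 2)).boundary Mminus)
    (hiplus : Set.range iplus = (𝓡∂ (m + 2)).boundary Mplus)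
    (Lminus kminus : ∀ p : N, TangentSpace (𝓡∂ (m + 2)) (iminus p))
    (Lplus kplus : ∀ p : N, TangentSpace (𝓡∂ (m + 2)) (iplus p))
    (hDminus : IsEmbeddedData D gminus iminus Lminus)
    (hDplus : IsEmbeddedData Dhat gplus iplus Lplus)
    (vminus : Mminus → ℝ) (vplus : Mplus → ℝ)
    (hfolminus : IsFoliatedGauge (J := 𝓡 (m + 1)) gminus iminus Lminus kminus vminus)
    (hfolplus : IsFoliatedGauge (J := 𝓡 (m + 1)) gplus iplus Lplus kplus vplus)
    (φ : N ≃ₘ⟮𝓡 (m + 1), 𝓡 (m + 1)⟯ N) (z : N → ℝ) (V : VField (𝓡 (m + 1)) N)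
    (hmatch : IsGaugeMatching D.toMetricHypersurfaceData Dhat.toMetricHypersurfaceData φ z V)
    (lam v Hstep nH : N → ℝ) (dH : CovField (𝓡 (m + 1)) N) (Yplus jumpY : BilinField (𝓡 (m + 1)) N)
    (hlam : lam = vminus ∘ iminus) (hv : v = vplus ∘ iplus) (hHstep : Hstep = v ∘ φ)
    (hdH : dH = differential Hstep) (hnH : nH = fun p => dH p (D.n p))
    (hYplus : Yplus = fun p => (1 / 2 : ℝ) •
      pullLie gplus.g (iplus ∘ φ) (matchingRigging iplus Lplus φ z V) p)
    (hjumpY : jumpY = fun p => Yplus p - D.Y p) :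
    (∀ p, nH p ≠ 0 ∧ z p = 1 / nH p) ∧
    (∀ (p : N) (e : Fin m → TangentSpace (𝓡 (m + 1)) p),
      IsAdaptedFrame D.toMetricHypersurfaceData lam p e →
      V p = ∑ A, ∑ B, (invMetric D.toMetricHypersurfaceData p e A B * dH p (e A)) •
        ((dH p (e B) / (2 * nH p)) • D.n p - e B)) ∧
    (∀ (p : N) (e : Fin m → TangentSpace (𝓡 (m + 1)) p),
      IsAdaptedFrame D.toMetricHypersurfaceData lam p e →
      ∀ u w : TangentSpace (𝓡 (m + 1)) p,
        jumpY p u w = 1 / nH p * (pullbackBilin (J := 𝓡 (m + 1)) φ Dhat.Y p u w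
          + (∑ A, ∑ B, invMetric D.toMetricHypersurfaceData p e A B * dH p (e A) * dH p (e B))
            / (2 * nH p) * D.U p u w
          - D.toMetricHypersurfaceData.hessian Hstep p u w) - D.Y p u w) ∧
    (∀ p, jumpY p (D.n p) (D.n p)
      = nH p * Dhat.Y (φ p) (Dhat.n (φ p)) (Dhat.n (φ p)) - D.Y p (D.n p) (D.n p)
        - differential nH p (D.n p) / nH p) ∧
    (∀ (p : N) (e : Fin m → TangentSpace (𝓡 (m + 1)) p),
      IsAdaptedFrame D.toMetricHypersurfaceData lam p e →
      ∀ W : Fin m → TangentSpace (𝓡 (m + 1)) (φ p),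
      (∀ A, W A = mfderiv (𝓡 (m + 1)) (𝓡 (m + 1)) φ p (e A) - dH p (e A) • Dhat.n (φ p)) →
      ∀ A, jumpY p (D.n p) (e A)
        = Dhat.Y (φ p) (Dhat.n (φ p)) (W A)
          + dH p (e A) * Dhat.Y (φ p) (Dhat.n (φ p)) (Dhat.n (φ p))
          - D.Y p (D.n p) (e A) - differential nH p (e A) / nH p
          + (∑ K, ∑ L, invMetric D.toMetricHypersurfaceData p e K L * dH p (e K)
              * D.U p (e A) (e L)) / nH p) ∧
    (∀ (S : Type*) [TopologicalSpace S] [ChartedSpace (EuclideanSpace ℝ (Fin m)) S]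
        [IsManifold (𝓡 m) ∞ S] (ψ : S → N) (c : ℝ),
      Manifold.IsSmoothEmbedding (𝓡 m) (𝓡 (m + 1)) ∞ ψ → Set.range ψ = lam ⁻¹' {c} →
      ∀ (s : S) (w : Fin m → TangentSpace (𝓡 m) s)
        (e : Fin m → TangentSpace (𝓡 (m + 1)) (ψ s)),
      (∀ A, e A = mfderiv (𝓡 m) (𝓡 (m + 1)) ψ s (w A)) →
      IsAdaptedFrame D.toMetricHypersurfaceData lam (ψ s) e →
      ∀ W : Fin m → TangentSpace (𝓡 (m + 1)) (φ (ψ s)),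
      (∀ A, W A = mfderiv (𝓡 (m + 1)) (𝓡 (m + 1)) φ (ψ s) (e A)
        - dH (ψ s) (e A) • Dhat.n (φ (ψ s))) →
      ∀ A B, jumpY (ψ s) (e A) (e B)
        = 1 / nH (ψ s) * (Dhat.Y (φ (ψ s)) (W A) (W B)
          + (dH (ψ s) (e A) * Dhat.Y (φ (ψ s)) (Dhat.n (φ (ψ s))) (W B)
            + dH (ψ s) (e B) * Dhat.Y (φ (ψ s)) (Dhat.n (φ (ψ s))) (W A))
          + dH (ψ s) (e A) * dH (ψ s) (e B)
            * Dhat.Y (φ (ψ s)) (Dhat.n (φ (ψ s))) (Dhat.n (φ (ψ s)))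
          - nH (ψ s) * D.Y (ψ s) (e A) (e B)
          + (∑ K, ∑ L, invMetric D.toMetricHypersurfaceData (ψ s) e K L
              * dH (ψ s) (e K) * dH (ψ s) (e L)) / (2 * nH (ψ s)) * D.U (ψ s) (e A) (e B)
          - hessian (pullbackBilin (J := 𝓡 m) ψ D.γ) (Hstep ∘ ψ) s (w A) (w B))) := by
  subst hlam hv hHstep hdH hYplus hjumpY
  have hφ := φ.contMDiff
  obtain ⟨hl, hl2⟩ := hfolminus.l_eq hDminus hD
  obtain ⟨hl', hl2'⟩ := hfolplus.l_eq hDplus hDhat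
  have hv := hfolplus.smooth_v
  have hlam := hfolminus.smooth_v
  have hH : ContMDiff (𝓡 (m + 1)) 𝓘(ℝ, ℝ) ∞ ((vplus ∘ iplus) ∘ φ) := hv.comp hφ
  set dH : ∀ p : N, EuclideanSpace ℝ (Fin (m + 1)) →L[ℝ] ℝ :=
    fun p => covAt (differential (I := 𝓡 (m + 1)) ((vplus ∘ iplus) ∘ φ)) p with hdH
  have hnH' : ∀ p, nH p = dH p (D.nAt p) := fun p => by rw [hnH]; rfl
  have gauge := fun p => hmatch.gauge_equations hD hl2 hl2' hl' hv p rfl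
  have hz : ∀ p, nH p ≠ 0 ∧ z p = 1 / nH p := fun p => by
    have h1 : z p * nH p = 1 := by rw [hnH']; exact (gauge p).1
    have h2 : nH p ≠ 0 := right_ne_zero_of_mul_eq_one h1
    exact ⟨h2, eq_one_div_of_mul_eq_one_left h1⟩
  -- The jump with `ℓ(V)` left unevaluated, which needs no frame; all component formulas start from
  -- it.
  set J : ∀ p : N, EuclideanSpace ℝ (Fin (m + 1)) → EuclideanSpace ℝ (Fin (m + 1)) → ℝ :=
    fun p u w => 1 / nH p * (bilinAt (pullbackBilin (J := 𝓡 (m + 1)) φ Dhat.Y) p u w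
        + covAt D.l p (vecAt (V p)) * bilinAt D.U p u w
        - D.toMetricHypersurfaceData.hessian ((vplus ∘ iplus) ∘ φ) p u w) - bilinAt D.Y p u w
  have hJ : ∀ p u w, J p u w = 1 / nH p
      * (bilinAt (pullbackBilin (J := 𝓡 (m + 1)) φ Dhat.Y) p u w
        + covAt D.l p (vecAt (V p)) * bilinAt D.U p u w
        - D.toMetricHypersurfaceData.hessian ((vplus ∘ iplus) ∘ φ) p u w) - bilinAt D.Y p u w :=
    fun _ _ _ => rfl
  have jump : ∀ (p : N) (u w : EuclideanSpace ℝ (Fin (m + 1))),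
      (1 / 2) * bilinAt (pullLie (J := 𝓡 (m + 1)) gplus.g (iplus ∘ φ)
        (matchingRigging iplus Lplus φ z V)) p u w - bilinAt D.Y p u w = J p u w := by
    intro p u w
    rw [half_pullLie_matchingRigging hD hl2 hlam hl hl2' hl' hv hDplus hmatch, (hz p).2]
  have frame : ∀ (p : N) (e : Fin m → TangentSpace (𝓡 (m + 1)) p),
      IsAdaptedFrame D.toMetricHypersurfaceData (vminus ∘ iminus) p e →
      IsTransverseFrame D.toMetricHypersurfaceData p e := fun p e he => he.isTransverseFrame hl
  have gv := fun (p : N) (e : Fin m → TangentSpace (𝓡 (m + 1)) p)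
      (he : IsAdaptedFrame D.toMetricHypersurfaceData (vminus ∘ iminus) p e) =>
    (frame p e he).gaugeVector hD (h := dH p) (V := vecAt (V p))
      (by rw [← hnH']; exact (hz p).1) (gauge p).2.1 (gauge p).2.2
  have push_n : ∀ p, pushforward (𝓡 (m + 1)) (𝓡 (m + 1)) φ p (D.nAt p)
      = nH p • Dhat.nAt (φ p) := fun p => by
    rw [hnH']
    exact pushforward_n hD hDhat hmatch.γ_eq (covAt_pullback_differential hl' hv p)
  have hess_n : ∀ (p : N) (u : EuclideanSpace ℝ (Fin (m + 1))),
      D.toMetricHypersurfaceData.hessian ((vplus ∘ iplus) ∘ φ) p u (D.nAt p)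
        = covAt (differential (I := 𝓡 (m + 1)) nH) p u + bilinAt D.U p u (vecAt (V p)) := by
    intro p u
    rw [hnH]
    exact hD.hessian_n hH (hl2 p)
      (fun a b => by rw [hl]; exact partialCov_differential_symm hlam p a b) (gauge p).2.1 u
  have U_symm : ∀ (p : N) (a b : EuclideanSpace ℝ (Fin (m + 1))),
      bilinAt D.U p a b = bilinAt D.U p b a := fun p a b => D.U_symm p a b
  have Y_symm : ∀ (p : N) (a b : EuclideanSpace ℝ (Fin (m + 1))),
      bilinAt Dhat.Y p a b = bilinAt Dhat.Y p b a := fun p a b => Dhat.symm_Y p a b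
  refine ⟨hz, fun p e he => ?_, fun p e he u w => ?_, fun p => ?_, fun p e he W hW A => ?_, ?_⟩
  · have h1 := (gv p e he).2.1
    rw [← hnH'] at h1
    exact h1
  · have h1 := (gv p e he).1
    rw [← hnH'] at h1
    refine (jump p u w).trans ?_
    change 1 / nH p * (_ + _ * _ - _) - _ = _
    rw [h1]
    rfl
  · refine (jump p (D.nAt p) (D.nAt p)).trans ?_
    have h0 : bilinAt (pullbackBilin (J := 𝓡 (m + 1)) φ Dhat.Y) p (D.nAt p) (D.nAt p)
        = nH p * (nH p * bilinAt Dhat.Y (φ p) (Dhat.nAt (φ p)) (Dhat.nAt (φ p))) := by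
      change bilinAt Dhat.Y (φ p) (pushforward (𝓡 (m + 1)) (𝓡 (m + 1)) φ p (D.nAt p))
        (pushforward (𝓡 (m + 1)) (𝓡 (m + 1)) φ p (D.nAt p)) = _
      simp only [push_n, map_smul, smul_apply, smul_eq_mul]
    change 1 / nH p * (bilinAt (pullbackBilin (J := 𝓡 (m + 1)) φ Dhat.Y) p (D.nAt p) (D.nAt p)
      + _ * bilinAt D.U p (D.nAt p) (D.nAt p) - _) - _
      = nH p * bilinAt Dhat.Y (φ p) (Dhat.nAt (φ p)) (Dhat.nAt (φ p))
        - bilinAt D.Y p (D.nAt p) (D.nAt p)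
        - covAt (differential (I := 𝓡 (m + 1)) nH) p (D.nAt p) / nH p
    -- `U` vanishes on `n`, so the Hessian contributes only `n(n(H))`.
    rw [h0, hD.U_n, hess_n, U_symm, hD.U_n]
    have := (hz p).1
    field_simp
    ring
  · refine (jump p (D.nAt p) (e A)).trans ?_
    have h1 : pushforward (𝓡 (m + 1)) (𝓡 (m + 1)) φ p (vecAt (e A))
        = vecAt (W A) + dH p (vecAt (e A)) • Dhat.nAt (φ p) := by
      rw [hW]; exact (sub_add_cancel _ _).symm
    have h0 : bilinAt (pullbackBilin (J := 𝓡 (m + 1)) φ Dhat.Y) p (D.nAt p) (vecAt (e A))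
        = nH p * (bilinAt Dhat.Y (φ p) (Dhat.nAt (φ p)) (vecAt (W A))
          + dH p (vecAt (e A)) * bilinAt Dhat.Y (φ p) (Dhat.nAt (φ p)) (Dhat.nAt (φ p))) := by
      change bilinAt Dhat.Y (φ p) (pushforward (𝓡 (m + 1)) (𝓡 (m + 1)) φ p (D.nAt p))
        (pushforward (𝓡 (m + 1)) (𝓡 (m + 1)) φ p (vecAt (e A))) = _
      simp only [push_n, h1, map_smul, map_add, smul_apply, smul_eq_mul]
      ring
    -- The covector `U(e_A, ·)` kills `n`, so only the leaf part of `V` contributes to `U(e_A, V)`.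
    -- Its minus sign meets that of the Hessian, whence the positive `U` term.
    have h2 := (gv p e he).2.2 (bilinAt D.U p (vecAt (e A))) (hD.U_n p _)
    change 1 / nH p * (bilinAt (pullbackBilin (J := 𝓡 (m + 1)) φ Dhat.Y) p (D.nAt p)
        (vecAt (e A)) + _ * bilinAt D.U p (D.nAt p) (vecAt (e A))
        - D.toMetricHypersurfaceData.hessian ((vplus ∘ iplus) ∘ φ) p (D.nAt p) (vecAt (e A)))
        - bilinAt D.Y p (D.nAt p) (vecAt (e A))
      = bilinAt Dhat.Y (φ p) (Dhat.nAt (φ p)) (vecAt (W A))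
        + dH p (vecAt (e A)) * bilinAt Dhat.Y (φ p) (Dhat.nAt (φ p)) (Dhat.nAt (φ p))
        - bilinAt D.Y p (D.nAt p) (vecAt (e A))
        - covAt (differential (I := 𝓡 (m + 1)) nH) p (vecAt (e A)) / nH p
        + (∑ K, ∑ L, (IsTransverseFrame.gram D.toMetricHypersurfaceData p e)⁻¹ K L * dH p (e K)
          * bilinAt D.U p (vecAt (e A)) (e L)) / nH p
    rw [h0, MetricHypersurfaceData.hessian_symm hH, hess_n, U_symm, hD.U_n, h2]
    have := (hz p).1
    field_simp
    ring
  · intro S _ _ _ ψ c hψ hrange s w e hew he W hW A B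
    refine (jump (ψ s) (e A) (e B)).trans ?_
    have h1 : ∀ A, pushforward (𝓡 (m + 1)) (𝓡 (m + 1)) φ (ψ s) (vecAt (e A))
        = vecAt (W A) + dH (ψ s) (vecAt (e A)) • Dhat.nAt (φ (ψ s)) := fun A => by
      rw [hW]; exact (sub_add_cancel _ _).symm
    have h0 : bilinAt (pullbackBilin (J := 𝓡 (m + 1)) φ Dhat.Y) (ψ s) (vecAt (e A)) (vecAt (e B))
        = bilinAt Dhat.Y (φ (ψ s)) (vecAt (W A)) (vecAt (W B))
          + (dH (ψ s) (vecAt (e A)) * bilinAt Dhat.Y (φ (ψ s)) (Dhat.nAt (φ (ψ s))) (vecAt (W B))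
            + dH (ψ s) (vecAt (e B))
              * bilinAt Dhat.Y (φ (ψ s)) (Dhat.nAt (φ (ψ s))) (vecAt (W A)))
          + dH (ψ s) (vecAt (e A)) * dH (ψ s) (vecAt (e B))
            * bilinAt Dhat.Y (φ (ψ s)) (Dhat.nAt (φ (ψ s))) (Dhat.nAt (φ (ψ s))) := by
      change bilinAt Dhat.Y (φ (ψ s))
        (pushforward (𝓡 (m + 1)) (𝓡 (m + 1)) φ (ψ s) (vecAt (e A)))
        (pushforward (𝓡 (m + 1)) (𝓡 (m + 1)) φ (ψ s) (vecAt (e B))) = _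
      simp only [h1, map_smul, map_add, smul_apply, add_apply, smul_eq_mul]
      rw [Y_symm _ (vecAt (W A)) (Dhat.nAt _)]
      ring
    have h2 := (gv (ψ s) e he).1
    rw [← hnH'] at h2
    have hf := frame (ψ s) e he
    have heq : (e : Fin m → EuclideanSpace ℝ (Fin (m + 1)))
        = fun A => pushforward (𝓡 (m + 1)) (𝓡 m) ψ s (vecAt (w A)) := funext hew
    -- Independence of the images `e_A` forces independence of the `w_A`, and `m` independent
    -- vectors span the `m`-dimensional tangent space of the leaf.
    have hwi : LinearIndependent ℝ (fun A => vecAt (w A)) := by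
      have := hf.indep
      rw [heq] at this
      exact LinearIndependent.of_comp (pushforward (𝓡 (m + 1)) (𝓡 m) ψ s).toLinearMap this
    have hspan : Submodule.span ℝ (Set.range fun A => vecAt (w A)) = ⊤ :=
      hwi.span_eq_top_of_card_eq_finrank' (by simp)
    rw [heq] at hf
    have h3 := hessian_leaf hD hl2 hlam hl hψ.contMDiff (c := c)
      (fun t => by
        have : ψ t ∈ (vminus ∘ iminus) ⁻¹' {c} := hrange ▸ Set.mem_range_self t
        exact this) hspan hf hH (vecAt (w A)) (vecAt (w B))
    have h4 : D.toMetricHypersurfaceData.hessian ((vplus ∘ iplus) ∘ φ) (ψ s) (vecAt (e A))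
        (vecAt (e B)) = hessian (pullbackBilin (J := 𝓡 m) ψ D.γ) (((vplus ∘ iplus) ∘ φ) ∘ ψ) s
          (vecAt (w A)) (vecAt (w B)) := by
      have ea : ∀ A, vecAt (e A) = pushforward (𝓡 (m + 1)) (𝓡 m) ψ s (vecAt (w A)) := hew
      rw [ea A, ea B]
      exact h3.symm
    -- Moves `Y⁻` inside the bracket with the factor `n(H)`.
    have h5 : 1 / nH (ψ s) * nH (ψ s) = 1 := one_div_mul_cancel (hz (ψ s)).1
    have h6 : J (ψ s) (vecAt (e A)) (vecAt (e B)) = 1 / nH (ψ s)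
        * (bilinAt Dhat.Y (φ (ψ s)) (vecAt (W A)) (vecAt (W B))
          + (dH (ψ s) (vecAt (e A)) * bilinAt Dhat.Y (φ (ψ s)) (Dhat.nAt (φ (ψ s))) (vecAt (W B))
            + dH (ψ s) (vecAt (e B))
              * bilinAt Dhat.Y (φ (ψ s)) (Dhat.nAt (φ (ψ s))) (vecAt (W A)))
          + dH (ψ s) (vecAt (e A)) * dH (ψ s) (vecAt (e B))
            * bilinAt Dhat.Y (φ (ψ s)) (Dhat.nAt (φ (ψ s))) (Dhat.nAt (φ (ψ s)))
          - nH (ψ s) * bilinAt D.Y (ψ s) (vecAt (e A)) (vecAt (e B))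
          + (∑ K, ∑ L, (IsTransverseFrame.gram D.toMetricHypersurfaceData (ψ s) e)⁻¹ K L
              * dH (ψ s) (e K) * dH (ψ s) (e L)) / (2 * nH (ψ s))
            * bilinAt D.U (ψ s) (vecAt (e A)) (vecAt (e B))
          - hessian (pullbackBilin (J := 𝓡 m) ψ D.γ) (((vplus ∘ iplus) ∘ φ) ∘ ψ) s
              (vecAt (w A)) (vecAt (w B))) := by
      rw [hJ, h0, h2, h4]
      linear_combination bilinAt D.Y (ψ s) (vecAt (e A)) (vecAt (e B)) * h5
    exact h6
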